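/- Let $n\ge 1$, let $u=(u_1,u_2,u_3)$ and $v=(v_1,\dots,v_n)$ be vectors of positive real numbers, and let $$P=\Big\{\,y\in\mathbb{R}^{3\times n} : \sum_{j=1}^n y_{ij}=u_i\ (i=1,2,3),\quad \sum_{i=1}^3 y_{ij}=v_j\ (j=1,\dots,n),\quad y_{ij}\ge 0 \text{ for all } i,j\,\Big\}$$ be the $3\times n$ transportation polytope with margins $u,v$, assumed nonempty (equivalently, $\sum_i u_i=\sum_j v_j$). Call a pair $(i,j)$ a *critical edge* of $P$ if $y_{ij}>0$ for every $y\in P$, and let $k$ be the number of critical edges. Consider the graph of $P$, whose nodes are the vertices of $P$, two distinct vertices being adjacent when the segment joining them is an edge (a one-dimensional face) of $P$. Then any two vertices of $P$ are joined by a path of at most $n+2-k$ edges in this graph, i.e. the graph diameter of $P$ is at most $n+2-k$, which is the Hirsch bound for $P$. In particular, the graph diameter of $P$ is at most $n+2$. -/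

import Mathlib

/-- The `m × n` transportation polytope with margins `u` and `v`: all nonnegative real `m × n`
matrices with row sums `u` and column sums `v`. -/
def transportationPolytope {m n : ℕ} (u : Fin m → ℝ) (v : Fin n → ℝ) :
    Set (Matrix (Fin m) (Fin n) ℝ) :=
  {y | (∀ i, ∑ j, y i j = u i) ∧ (∀ j, ∑ i, y i j = v j) ∧ ∀ i j, 0 ≤ y i j}

/-- The graph (1-skeleton) of a polytope `P`. Its nodes are the vertices (extreme points) of `P`;
two distinct vertices are adjacent when the segment joining them is a face of `P`, that is,
an edge of `P`. -/
def polytopeGraph {E : Type*} [AddCommGroup E] [Module ℝ E] (P : Set E) :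
    SimpleGraph (P.extremePoints ℝ) where
  Adj x y := x ≠ y ∧ IsExtreme ℝ P (segment ℝ (x : E) (y : E))
  symm := ⟨fun x y h => ⟨h.1.symm, by rw [segment_symm]; exact h.2⟩⟩
  loopless := ⟨fun _ h => h.1 rfl⟩

/-- The critical edges of a transportation polytope: the edges `(i, j)` of the complete bipartite
graph that carry positive flow in every point of the polytope. -/
def criticalEdges {m n : ℕ} (u : Fin m → ℝ) (v : Fin n → ℝ) : Set (Fin m × Fin n) :=
  {e | ∀ y ∈ transportationPolytope u v, 0 < y e.1 e.2}

/-!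
# The Hirsch bound for `3 × n` transportation polytopes

The vertices of a transportation polytope are its basic feasible solutions, and the argument
follows their supports.

*Generic margins.* Suppose that no row margin is a sum of column margins. Then the support of a
basic solution is a spanning tree of `K_{3,n}` (`IsBasic.classify`): either one column meets all
three rows (a star), or two columns join the rows to a path `X - p - Y - q - Z`; all other columns
are leaves. A pivot brings one cell into the support and removes one, namely a smallest of the
decreasing cells on the cycle that is closed (`IsBasic.pivot_two`, `IsBasic.pivot_three`).

Fix a target vertex `f`. Each column `j` gets a row `π j` serving it in `f`, and the support of `f`
consists of the cells `(π j, j)` and of two more cells `h₁`, `h₂`. For a vertex `y` let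
`flow R S` be the amount that row `R` ships to columns meant for row `S`. The net outflow of every
row is the same for all `y` with the given margins (`IsBasic.balance`), so it can be read off from
`f`, and this controls which of the decreasing cells of a pivot can be the smallest.

* If the arcs `R → S` with positive flow form an acyclic digraph, some pivot brings in a cell of
  the target, removes a cell outside it and keeps the digraph acyclic (`PathTarget.improve`,
  `StarTarget.improve`). The distance to `f` is then at most the number of missing target cells.
* If there is a cycle, and no pivot trades a cell `(π j, j)` for a cell not of this form, the
  classification of supports leaves only the case that the support is a path `X - p - Y - q - Z`
  whose middle row is a source or a sink of the flow
  (`IsBasic.acyclic_or_of_not_improvable`). Then one of `h₁`, `h₂` is incident to `Y` or serves a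
  column meant for `Y`. It is brought in at no loss of cells `(π j, j)`, and afterwards it never
  has to leave while cells `(π j, j)` are brought in until the flow is acyclic
  (`IsBasic.improve_of_sink`, `IsBasic.improve_of_source`).

Hence `f` is reached from `y` by as many pivots as there are missing cells `(π j, j)`, plus one
for each of `h₁`, `h₂` that is not contained in every support. Critical cells belong to every
support, so this is at most `n + 2 - k` (`exists_pivotWalk`).

*Arbitrary margins.* Perturbing the margins in a generic direction gives generic margins for all
small perturbations. There are finitely many supports, so for a small perturbation every support
that occurs also occurs for arbitrarily small ones, and a basic solution with this support tends
to a vertex of the original polytope (`exists_limit`). Every vertex arises in this way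
(`IsBasic.eventually_exists_supp_subset`), critical cells stay in all supports, and a pivot becomes
an edge or is contracted (`IsPivot.eq_or_isExtreme_segment`).
-/

namespace Transport

open Finset

variable {n : ℕ}

/-! ### Row labellings and supports -/

/-- The three rows, listed in some order without repetition. -/
structure RowLabelling (X Y Z : Fin 3) : Prop where
  xy : X ≠ Y
  xz : X ≠ Z
  yz : Y ≠ Z

namespace RowLabelling

variable {X Y Z : Fin 3}

theorem rev (h : RowLabelling X Y Z) : RowLabelling Z Y X := ⟨h.yz.symm, h.xz.symm, h.xy.symm⟩

theorem swap (h : RowLabelling X Y Z) : RowLabelling Y X Z := ⟨h.xy.symm, h.yz, h.xz⟩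

theorem swap' (h : RowLabelling X Y Z) : RowLabelling X Z Y := ⟨h.xz, h.xy, h.yz.symm⟩

theorem eq_or (h : RowLabelling X Y Z) (i : Fin 3) : i = X ∨ i = Y ∨ i = Z := by
  have h1 := h.xy
  have h2 := h.xz
  have h3 := h.yz
  omega

theorem univ_eq (h : RowLabelling X Y Z) : (univ : Finset (Fin 3)) = {X, Y, Z} := by
  ext i
  simpa using h.eq_or i

theorem sum_eq {M : Type*} [AddCommMonoid M] (h : RowLabelling X Y Z) (f : Fin 3 → M) :
    ∑ i, f i = f X + f Y + f Z := by
  rw [h.univ_eq, sum_insert (by simp [h.xy, h.xz]), sum_insert (by simp [h.yz]), sum_singleton,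
    add_assoc]

theorem forall_iff (h : RowLabelling X Y Z) {P : Fin 3 → Prop} :
    (∀ i, P i) ↔ P X ∧ P Y ∧ P Z :=
  ⟨fun H => ⟨H _, H _, H _⟩, fun H i => by
    rcases h.eq_or i with rfl | rfl | rfl
    exacts [H.1, H.2.1, H.2.2]⟩

end RowLabelling

/-- The support of a matrix: the cells with a positive entry. -/
noncomputable def supp (y : Matrix (Fin 3) (Fin n) ℝ) : Finset (Fin 3 × Fin n) :=
  univ.filter fun e => 0 < y e.1 e.2

@[simp] theorem mem_supp {y : Matrix (Fin 3) (Fin n) ℝ} {e : Fin 3 × Fin n} :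
    e ∈ supp y ↔ 0 < y e.1 e.2 := by
  simp [supp]

/-! ### Basic solutions and pivots -/

/-- Matrices all of whose row sums and column sums vanish. -/
structure ZeroMargin (z : Matrix (Fin 3) (Fin n) ℝ) : Prop where
  row : ∀ i, ∑ j, z i j = 0
  col : ∀ j, ∑ i, z i j = 0

theorem ZeroMargin.sub_smul {z w : Matrix (Fin 3) (Fin n) ℝ} (hz : ZeroMargin z)
    (hw : ZeroMargin w) (s : ℝ) : ZeroMargin (Matrix.of fun i j => z i j - s * w i j) := by
  constructor
  · intro i
    simp [sum_sub_distrib, ← mul_sum, hz.row, hw.row]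
  · intro j
    simp [sum_sub_distrib, ← mul_sum, hz.col, hw.col]

/-- A basic feasible solution: a point of the transportation polytope whose support carries no
nonzero matrix with vanishing margins. -/
structure IsBasic (u : Fin 3 → ℝ) (v : Fin n → ℝ) (y : Matrix (Fin 3) (Fin n) ℝ) : Prop where
  nonneg : ∀ i j, 0 ≤ y i j
  row : ∀ i, ∑ j, y i j = u i
  col : ∀ j, ∑ i, y i j = v j
  ker : ∀ z : Matrix (Fin 3) (Fin n) ℝ, ZeroMargin z → (∀ i j, y i j = 0 → z i j = 0) →
    ∀ i j, z i j = 0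

/-- Generic margins: the columns are positive and no row margin is a sum of column margins. -/
structure Generic (u : Fin 3 → ℝ) (v : Fin n → ℝ) : Prop where
  pos : ∀ j, 0 < v j
  ne : ∀ i (J : Finset (Fin n)), u i ≠ ∑ j ∈ J, v j

/-- The matrix with `1` at `(R, p)`, `-1` at `(S, p)`, and zeros elsewhere. -/
def arc (p : Fin n) (R S : Fin 3) : Matrix (Fin 3) (Fin n) ℝ :=
  Matrix.of fun i j => if j = p then (if i = R then 1 else 0) - (if i = S then 1 else 0) else 0

theorem arc_apply (p : Fin n) (R S i : Fin 3) (j : Fin n) : arc p R S i j =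
    if j = p then (if i = R then 1 else 0) - (if i = S then 1 else 0) else 0 := rfl

theorem arc_eq_zero {p : Fin n} {R S i : Fin 3} {j : Fin n} (h : j = p → i ≠ R ∧ i ≠ S) :
    arc p R S i j = 0 := by
  rw [arc_apply]
  split_ifs with h1 h2 h3 h3
  exacts [absurd h2 (h h1).1, absurd h2 (h h1).1, absurd h3 (h h1).2, sub_zero 0, rfl]

theorem arc_nonneg {p : Fin n} {R S i : Fin 3} {j : Fin n} (h : j = p → i ≠ S) :
    0 ≤ arc p R S i j := by
  rw [arc_apply]
  split_ifs with h1 h2 h3 h3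
  exacts [absurd h3 (h h1), by norm_num, absurd h3 (h h1), by norm_num, le_rfl]

theorem arc_row (p : Fin n) (R S i : Fin 3) :
    ∑ j, arc p R S i j = (if i = R then 1 else 0) - (if i = S then 1 else 0) := by
  simp [arc_apply]

theorem arc_col (p : Fin n) (R S : Fin 3) (j : Fin n) : ∑ i, arc p R S i j = 0 := by
  by_cases h : j = p <;> simp [arc_apply, h, sum_sub_distrib]

/-- The circulation around the cycle `R - p - S - q - R`. -/
theorem zeroMargin_two (p q : Fin n) (R S : Fin 3) :
    ZeroMargin (Matrix.of fun i j => arc p R S i j + arc q S R i j) := by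
  constructor
  · intro i
    simp [sum_add_distrib, arc_row]
  · intro j
    simp [sum_add_distrib, arc_col]

/-- The circulation around the cycle `R - p - S - q - T - r - R`. -/
theorem zeroMargin_three (p q r : Fin n) (R S T : Fin 3) :
    ZeroMargin (Matrix.of fun i j => arc p R S i j + arc q S T i j + arc r T R i j) := by
  constructor
  · intro i
    simp [sum_add_distrib, arc_row]
  · intro j
    simp [sum_add_distrib, arc_col]

/-- The column `j` has a single positive entry, in row `R`. -/
def IsLeaf (y : Matrix (Fin 3) (Fin n) ℝ) (j : Fin n) (R : Fin 3) : Prop :=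
  0 < y R j ∧ ∀ S, S ≠ R → y S j = 0

/-- The support is a path `X - p - Y - q - Z` together with leaf columns. -/
structure IsPath (y : Matrix (Fin 3) (Fin n) ℝ) (X Y Z : Fin 3) (p q : Fin n) : Prop where
  lab : RowLabelling X Y Z
  ne : p ≠ q
  xp : 0 < y X p
  yp : 0 < y Y p
  zp : y Z p = 0
  xq : y X q = 0
  yq : 0 < y Y q
  zq : 0 < y Z q
  leaf : ∀ j, j ≠ p → j ≠ q → ∃ R, IsLeaf y j R

theorem IsPath.rev {y : Matrix (Fin 3) (Fin n) ℝ} {X Y Z : Fin 3} {p q : Fin n}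
    (h : IsPath y X Y Z p q) : IsPath y Z Y X q p :=
  ⟨h.lab.rev, h.ne.symm, h.zq, h.yq, h.xq, h.zp, h.yp, h.xp, fun j h1 h2 => h.leaf j h2 h1⟩

/-- The support consists of the full column `p` together with leaf columns. -/
structure IsStar (y : Matrix (Fin 3) (Fin n) ℝ) (p : Fin n) : Prop where
  full : ∀ i, 0 < y i p
  leaf : ∀ j, j ≠ p → ∃ R, IsLeaf y j R

theorem IsLeaf.unique {y : Matrix (Fin 3) (Fin n) ℝ} {j : Fin n} (h : ∃ R, IsLeaf y j R)
    {R S : Fin 3} (hRS : R ≠ S) (hR : 0 < y R j) : y S j = 0 := by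
  obtain ⟨T, -, hT⟩ := h
  by_cases hRT : R = T
  · exact hT S (hRT ▸ hRS.symm)
  · rw [hT R hRT] at hR
    exact absurd hR (lt_irrefl _)

theorem IsPath.unique {y : Matrix (Fin 3) (Fin n) ℝ} {X Y Z : Fin 3} {p q : Fin n}
    (h : IsPath y X Y Z p q) (j : Fin n) (R S : Fin 3) (hp : j ≠ p) (hq : j ≠ q) (hRS : R ≠ S)
    (hR : 0 < y R j) : y S j = 0 :=
  IsLeaf.unique (h.leaf j hp hq) hRS hR

theorem IsStar.unique {y : Matrix (Fin 3) (Fin n) ℝ} {p : Fin n} (h : IsStar y p) (j : Fin n)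
    (R S : Fin 3) (hp : j ≠ p) (hRS : R ≠ S) (hR : 0 < y R j) : y S j = 0 :=
  IsLeaf.unique (h.leaf j hp) hRS hR

section Basic

variable {u : Fin 3 → ℝ} {v : Fin n → ℝ} {y : Matrix (Fin 3) (Fin n) ℝ}

theorem IsBasic.pos_or_zero (hy : IsBasic u v y) (i : Fin 3) (j : Fin n) :
    0 < y i j ∨ y i j = 0 := by
  rcases (hy.nonneg i j).lt_or_eq with h | h
  exacts [Or.inl h, Or.inr h.symm]

theorem IsBasic.col_eq (hy : IsBasic u v y) {X Y Z : Fin 3} (h : RowLabelling X Y Z) (j : Fin n) :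
    y X j + y Y j + y Z j = v j := by
  rw [← hy.col j, h.sum_eq]

theorem IsBasic.leaf_eq (hy : IsBasic u v y) {j : Fin n} {R : Fin 3} (h : IsLeaf y j R) :
    y R j = v j := by
  rw [← hy.col j]
  exact (sum_eq_single R (fun S _ hS => h.2 S hS) (by simp)).symm

/-- Two columns of a basic solution have at most one row in common. -/
theorem IsBasic.no_two_cycle (hy : IsBasic u v y) {p q : Fin n} (hpq : p ≠ q) {R S : Fin 3}
    (hRS : R ≠ S) (h1 : 0 < y R p) (h2 : 0 < y S p) (h3 : 0 < y R q) (h4 : 0 < y S q) : False := by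
  have h := hy.ker _ (zeroMargin_two p q R S) (fun i j hij => by
    have : ∀ {i' : Fin 3} {j' : Fin n}, 0 < y i' j' → ¬ (j = j' ∧ i = i') := by
      rintro _ _ h ⟨rfl, rfl⟩
      exact h.ne' hij
    have a1 := this h1
    have a2 := this h2
    have a3 := this h3
    have a4 := this h4
    simp only [Matrix.of_apply, arc_apply]
    split_ifs <;> simp_all) R p
  simp [arc_apply, hpq, hRS] at h

/-- The support of a basic solution has no cycle through three columns. -/
theorem IsBasic.no_three_cycle (hy : IsBasic u v y) {p q r : Fin n} (hpq : p ≠ q) (hpr : p ≠ r)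
    (hqr : q ≠ r) {R S T : Fin 3} (hL : RowLabelling R S T) (h1 : 0 < y R p) (h2 : 0 < y S p)
    (h3 : 0 < y S q) (h4 : 0 < y T q) (h5 : 0 < y T r) (h6 : 0 < y R r) : False := by
  have h := hy.ker _ (zeroMargin_three p q r R S T) (fun i j hij => by
    have : ∀ {i' : Fin 3} {j' : Fin n}, 0 < y i' j' → ¬ (j = j' ∧ i = i') := by
      rintro _ _ h ⟨rfl, rfl⟩
      exact h.ne' hij
    have a1 := this h1
    have a2 := this h2
    have a3 := this h3
    have a4 := this h4
    have a5 := this h5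
    have a6 := this h6
    simp only [Matrix.of_apply, arc_apply]
    split_ifs <;> simp_all) R p
  simp [arc_apply, hpq, hpr, hL.xy] at h

theorem IsBasic.exists_pos (hg : Generic u v) (hy : IsBasic u v y) (j : Fin n) :
    ∃ i, 0 < y i j := by
  by_contra! h
  have := hg.pos j
  rw [← hy.col j] at this
  exact absurd this (not_lt.2 (sum_nonpos fun i _ => h i))

/-- For generic margins every row of a basic solution shares a column with another row;
otherwise its margin would be a sum of column margins. -/
theorem IsBasic.exists_mixed (hg : Generic u v) (hy : IsBasic u v y) (R : Fin 3) :
    ∃ j S, S ≠ R ∧ 0 < y R j ∧ 0 < y S j := by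
  by_contra! h
  apply hg.ne R (univ.filter fun j => 0 < y R j)
  rw [← hy.row R, sum_filter]
  refine sum_congr rfl fun j _ => ?_
  split_ifs with hj
  · exact hy.leaf_eq ⟨hj, fun S hS => le_antisymm (h j S hS hj) (hy.nonneg _ _)⟩
  · exact le_antisymm (not_lt.1 hj) (hy.nonneg _ _)

theorem IsBasic.leaf_of (hg : Generic u v) (hy : IsBasic u v y) {j : Fin n}
    (h : ∀ R S, R ≠ S → 0 < y R j → 0 < y S j → False) : ∃ R, IsLeaf y j R := by
  obtain ⟨R, hR⟩ := hy.exists_pos hg j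
  exact ⟨R, hR, fun S hS => (hy.pos_or_zero S j).resolve_left fun h' => h S R hS h' hR⟩

theorem IsBasic.isStar (hg : Generic u v) (hy : IsBasic u v y) {p : Fin n}
    (h : ∀ i, 0 < y i p) : IsStar y p :=
  ⟨h, fun _ hj => hy.leaf_of hg fun R S hRS hR hS => hy.no_two_cycle hj hRS hR hS (h R) (h S)⟩

theorem IsBasic.isPath (hg : Generic u v) (hy : IsBasic u v y) {X Y Z : Fin 3}
    (hL : RowLabelling X Y Z) {p q : Fin n} (hpq : p ≠ q) (h1 : 0 < y X p) (h2 : 0 < y Y p)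
    (h3 : 0 < y Y q) (h4 : 0 < y Z q) : IsPath y X Y Z p q := by
  refine ⟨hL, hpq, h1, h2, ?_, ?_, h3, h4, fun j hjp hjq => hy.leaf_of hg ?_⟩
  · exact (hy.pos_or_zero _ _).resolve_left fun h => hy.no_two_cycle hpq hL.yz h2 h h3 h4
  · exact (hy.pos_or_zero _ _).resolve_left fun h => hy.no_two_cycle hpq hL.xy h1 h2 h h3
  · have hXY : 0 < y X j → 0 < y Y j → False := fun a b => hy.no_two_cycle hjp hL.xy a b h1 h2
    have hYZ : 0 < y Y j → 0 < y Z j → False := fun a b => hy.no_two_cycle hjq hL.yz a b h3 h4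
    have hXZ : 0 < y X j → 0 < y Z j → False := fun a b =>
      hy.no_three_cycle hpq hjp.symm hjq.symm hL h1 h2 h3 h4 b a
    intro R S hRS
    rcases hL.eq_or R with rfl | rfl | rfl <;> rcases hL.eq_or S with rfl | rfl | rfl <;>
      intro a b
    exacts [hRS rfl, hXY a b, hXZ a b, hXY b a, hRS rfl, hYZ a b, hXZ b a, hYZ b a, hRS rfl]

/-- For generic margins the support of a basic solution is a star or a path. -/
theorem IsBasic.classify (hg : Generic u v) (hy : IsBasic u v y) {A B C : Fin 3}
    (hL : RowLabelling A B C) : (∃ p, IsStar y p) ∨ (∃ p q, IsPath y A B C p q) ∨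
      (∃ p q, IsPath y B A C p q) ∨ ∃ p q, IsPath y A C B p q := by
  by_cases hs : ∃ p, ∀ i, 0 < y i p
  · obtain ⟨p, hp⟩ := hs
    exact Or.inl ⟨p, hy.isStar hg hp⟩
  right
  have key : ∀ {X Y Z : Fin 3}, RowLabelling X Y Z → (∃ p, 0 < y X p ∧ 0 < y Y p) →
      (∃ q, 0 < y Y q ∧ 0 < y Z q) → ∃ p q, IsPath y X Y Z p q := by
    rintro X Y Z h ⟨p, h1, h2⟩ ⟨q, h3, h4⟩
    refine ⟨p, q, hy.isPath hg h ?_ h1 h2 h3 h4⟩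
    rintro rfl
    exact hs ⟨p, h.forall_iff.2 ⟨h1, h2, h4⟩⟩
  have link : ∀ {X Y Z : Fin 3}, RowLabelling X Y Z → (∃ p, 0 < y X p ∧ 0 < y Y p) ∨
      (∃ p, 0 < y X p ∧ 0 < y Z p) := by
    intro X Y Z h
    obtain ⟨j, S, hS, h1, h2⟩ := hy.exists_mixed hg X
    rcases h.eq_or S with rfl | rfl | rfl
    exacts [absurd rfl hS, Or.inl ⟨j, h1, h2⟩, Or.inr ⟨j, h1, h2⟩]
  have sym : ∀ {X Y : Fin 3}, (∃ p, 0 < y X p ∧ 0 < y Y p) → ∃ p, 0 < y Y p ∧ 0 < y X p :=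
    fun ⟨p, a, b⟩ => ⟨p, b, a⟩
  rcases link hL with hAB | hAC
  · rcases link hL.rev with hCB | hCA
    · exact Or.inl (key hL hAB (sym hCB))
    · exact Or.inr (Or.inl (key hL.swap (sym hAB) (sym hCA)))
  · rcases link hL.swap with hBA | hBC
    · exact Or.inr (Or.inl (key hL.swap hBA hAC))
    · exact Or.inr (Or.inr (key hL.swap' hAC (sym hBC)))

theorem card_supp_eq_sum (c : Fin n → ℕ)
    (hc : ∀ j, (∑ i, if 0 < y i j then 1 else 0) = c j) : (supp y).card = ∑ j, c j := by
  rw [supp, card_filter, Fintype.sum_prod_type, sum_comm]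
  exact sum_congr rfl fun j _ => hc j

/-- For generic margins every basic solution is nondegenerate. -/
theorem IsBasic.card_supp (hg : Generic u v) (hy : IsBasic u v y) : (supp y).card = n + 2 := by
  have leaf : ∀ {j R}, IsLeaf y j R → (∑ i, if 0 < y i j then 1 else 0) = 1 := by
    intro j R h
    rw [sum_eq_single R (fun S _ hS => by simp [h.2 S hS]) (by simp), if_pos h.1]
  have path : ∀ {X Y Z p q}, IsPath y X Y Z p q → (supp y).card = n + 2 := by
    intro X Y Z p q h
    rw [card_supp_eq_sum (fun j => 1 + (if j = p then 1 else 0) + (if j = q then 1 else 0))]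
    · simp [sum_add_distrib]
    · intro j
      by_cases hp : j = p
      · subst hp
        simp [h.lab.sum_eq, h.xp, h.yp, h.zp, h.ne]
      · by_cases hq : j = q
        · subst hq
          simp [h.lab.sum_eq, h.xq, h.yq, h.zq, h.ne.symm]
        · obtain ⟨R, hR⟩ := h.leaf j hp hq
          simp [leaf hR, hp, hq]
  have hL : RowLabelling 0 1 2 := by constructor <;> decide
  rcases hy.classify hg hL with ⟨p, h⟩ | ⟨p, q, h⟩ | ⟨p, q, h⟩ | ⟨p, q, h⟩
  · rw [card_supp_eq_sum (fun j => 1 + (if j = p then 2 else 0))]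
    · simp [sum_add_distrib]
    · intro j
      by_cases hp : j = p
      · subst hp
        simp [hL.sum_eq, h.full]
      · obtain ⟨R, hR⟩ := h.leaf j hp
        simp [leaf hR, hp]
  exacts [path h, path h, path h]

/-- A pivot: the basic solution `y'` arises from `y` when the cell `e` enters the support and the
cell `r` leaves it. -/
structure IsPivot (u : Fin 3 → ℝ) (v : Fin n → ℝ) (y : Matrix (Fin 3) (Fin n) ℝ)
    (e r : Fin 3 × Fin n) (y' : Matrix (Fin 3) (Fin n) ℝ) : Prop where
  basic : IsBasic u v y'
  enter : e ∉ supp y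
  leave : r ∈ supp y
  supp_eq : supp y' = insert e ((supp y).erase r)

/-- Moving along a circulation `C` through the new cell `e` until the cell `r` is exhausted. -/
theorem IsBasic.exists_isPivot (hg : Generic u v) (hy : IsBasic u v y)
    {C : Matrix (Fin 3) (Fin n) ℝ} (hC : ZeroMargin C) {e r : Fin 3 × Fin n}
    (he : y e.1 e.2 = 0) (hCe : C e.1 e.2 = 1) (hr : 0 < y r.1 r.2) (hCr : C r.1 r.2 = -1)
    (hsupp : ∀ i j, y i j = 0 → (i, j) ≠ e → C i j = 0)
    (hmin : ∀ i j, 0 ≤ y i j + y r.1 r.2 * C i j) : ∃ y', IsPivot u v y e r y' := by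
  set y' : Matrix (Fin 3) (Fin n) ℝ := Matrix.of fun i j => y i j + y r.1 r.2 * C i j with hy'
  have hb : IsBasic u v y' := by
    -- a circulation on the new support is a multiple of `C`, and `C` does not vanish at `r`
    refine ⟨hmin, fun i => ?_, fun j => ?_, fun z hz h => ?_⟩
    · simp [hy', sum_add_distrib, ← mul_sum, hC.row, hy.row]
    · simp [hy', sum_add_distrib, ← mul_sum, hC.col, hy.col]
    · have h1 := hy.ker _ (hz.sub_smul hC (z e.1 e.2)) (fun i j hij => by
        by_cases hije : (i, j) = e
        · subst hije
          simp [hCe]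
        · have hCij := hsupp i j hij hije
          have : z i j = 0 := h i j (by simp [hy', hij, hCij])
          simp [this, hCij])
      have h2 : z r.1 r.2 = 0 := h _ _ (by simp [hy', hCr])
      have h3 := h1 r.1 r.2
      simp only [Matrix.of_apply, h2, hCr] at h3
      have h4 : z e.1 e.2 = 0 := by linarith
      intro i j
      have h5 := h1 i j
      simpa [h4] using h5
  refine ⟨y', hb, by simp [he], by simpa using hr, ?_⟩
  -- the inclusion is an equality, since all basic solutions have supports of the same size
  have hsub : supp y' ⊆ insert e ((supp y).erase r) := by
    intro a ha
    rw [mem_supp] at ha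
    rw [mem_insert, mem_erase, mem_supp]
    by_cases hae : a = e
    · exact Or.inl hae
    · refine Or.inr ⟨?_, ?_⟩
      · rintro rfl
        simp [hy', hCr] at ha
      · refine (hy.pos_or_zero _ _).resolve_right fun h0 => ?_
        have := hsupp a.1 a.2 h0 hae
        simp [hy', h0, this] at ha
  refine eq_of_subset_of_card_le hsub ?_
  rw [hb.card_supp hg, card_insert_of_notMem (by simp [he]),
    card_erase_of_mem (by simpa using hr), hy.card_supp hg]
  rfl

/-- Some pivot lets `e` enter and `r` leave. -/
def CanPivot (u : Fin 3 → ℝ) (v : Fin n → ℝ) (y : Matrix (Fin 3) (Fin n) ℝ)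
    (e r : Fin 3 × Fin n) : Prop :=
  ∃ y', IsPivot u v y e r y'

/-- The cell `(R, p)` enters along the cycle `R - p - S - q - R`; the smaller one of the two
decreasing cells leaves. -/
theorem IsBasic.pivot_two (hg : Generic u v) (hy : IsBasic u v y) {p q : Fin n} {R S : Fin 3}
    (hpq : p ≠ q) (hRS : R ≠ S) (h1 : y R p = 0) (h2 : 0 < y S p) (h3 : 0 < y S q)
    (h4 : 0 < y R q) :
    (CanPivot u v y (R, p) (S, p) ∧ y S p ≤ y R q) ∨
      (CanPivot u v y (R, p) (R, q) ∧ y R q ≤ y S p) := by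
  have hs : ∀ i j, y i j = 0 → (i, j) ≠ (R, p) →
      (Matrix.of fun i j => arc p R S i j + arc q S R i j : Matrix _ _ ℝ) i j = 0 := by
    intro i j hij hne
    have : ∀ {i' : Fin 3} {j' : Fin n}, 0 < y i' j' → ¬ (j = j' ∧ i = i') := by
      rintro _ _ h ⟨rfl, rfl⟩
      exact h.ne' hij
    have a2 := this h2
    have a3 := this h3
    have a4 := this h4
    simp only [Matrix.of_apply, arc_apply]
    split_ifs <;> simp_all
  have hm : ∀ t : ℝ, 0 ≤ t → t ≤ y S p → t ≤ y R q → ∀ i j,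
      0 ≤ y i j + t * (Matrix.of fun i j => arc p R S i j + arc q S R i j : Matrix _ _ ℝ) i j := by
    intro t ht hp hq i j
    have hn := hy.nonneg i j
    by_cases hSp : j = p ∧ i = S
    · obtain ⟨rfl, rfl⟩ := hSp
      simp [arc_apply, hRS.symm, hpq, hp]
    by_cases hRq : j = q ∧ i = R
    · obtain ⟨rfl, rfl⟩ := hRq
      simp [arc_apply, hRS, hpq.symm, hq]
    simp only [Matrix.of_apply, arc_apply]
    split_ifs <;> simp_all
    all_goals linarith
  rcases le_total (y S p) (y R q) with hle | hle
  · refine Or.inl ⟨hy.exists_isPivot hg (zeroMargin_two p q R S) h1 ?_ h2 ?_ hs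
      (hm _ h2.le le_rfl hle), hle⟩
    · simp [arc_apply, hpq, hRS]
    · simp [arc_apply, hpq, hRS.symm]
  · refine Or.inr ⟨hy.exists_isPivot hg (zeroMargin_two p q R S) h1 ?_ h4 ?_ hs
      (hm _ h4.le hle le_rfl), hle⟩
    · simp [arc_apply, hpq, hRS]
    · simp [arc_apply, hpq.symm, hRS]

/-- The cell `(R, p)` enters along the cycle `R - p - S - q - T - r - R`; the smallest of the
three decreasing cells leaves. -/
theorem IsBasic.pivot_three (hg : Generic u v) (hy : IsBasic u v y) {p q r : Fin n}
    {R S T : Fin 3} (hL : RowLabelling R S T) (hpq : p ≠ q) (hpr : p ≠ r) (hqr : q ≠ r)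
    (h1 : y R p = 0) (h2 : 0 < y S p) (h3 : 0 < y S q) (h4 : 0 < y T q) (h5 : 0 < y T r)
    (h6 : 0 < y R r) :
    (CanPivot u v y (R, p) (S, p) ∧ y S p ≤ y T q ∧ y S p ≤ y R r) ∨
      (CanPivot u v y (R, p) (T, q) ∧ y T q ≤ y S p ∧ y T q ≤ y R r) ∨
      (CanPivot u v y (R, p) (R, r) ∧ y R r ≤ y S p ∧ y R r ≤ y T q) := by
  have hxy := hL.xy
  have hxz := hL.xz
  have hyz := hL.yz
  set C : Matrix (Fin 3) (Fin n) ℝ :=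
    Matrix.of fun i j => arc p R S i j + arc q S T i j + arc r T R i j with hCdef
  have hC : ∀ i j, C i j = arc p R S i j + arc q S T i j + arc r T R i j := fun _ _ => rfl
  have e1 : C R p = 1 := by simp [C, arc_apply, *]
  have e2 : C S p = -1 := by simp [C, arc_apply, *, hxy.symm]
  have e3 : C T q = -1 := by simp [C, arc_apply, *, hpq.symm, hyz.symm]
  have e4 : C R r = -1 := by simp [C, arc_apply, *, hpr.symm, hqr.symm]
  have hne : ∀ {i i' : Fin 3} {j j' : Fin n}, y i j = 0 → 0 < y i' j' → j = j' → i ≠ i' := by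
    rintro i i' j j' h0 h rfl rfl
    exact h.ne' h0
  have hs : ∀ i j, y i j = 0 → (i, j) ≠ (R, p) → C i j = 0 := by
    intro i j hij hne'
    have a1 : arc p R S i j = 0 := arc_eq_zero fun hj =>
      ⟨fun hi => hne' (by rw [hi, hj]), hne hij h2 hj⟩
    have a2 : arc q S T i j = 0 := arc_eq_zero fun hj => ⟨hne hij h3 hj, hne hij h4 hj⟩
    have a3 : arc r T R i j = 0 := arc_eq_zero fun hj => ⟨hne hij h5 hj, hne hij h6 hj⟩
    rw [hC, a1, a2, a3]
    norm_num
  have hpos : ∀ i j, ¬ (j = p ∧ i = S) → ¬ (j = q ∧ i = T) → ¬ (j = r ∧ i = R) → 0 ≤ C i j :=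
    fun i j a1 a2 a3 => add_nonneg (add_nonneg (arc_nonneg fun hj hi => a1 ⟨hj, hi⟩)
      (arc_nonneg fun hj hi => a2 ⟨hj, hi⟩)) (arc_nonneg fun hj hi => a3 ⟨hj, hi⟩)
  have hm : ∀ t : ℝ, 0 ≤ t → t ≤ y S p → t ≤ y T q → t ≤ y R r → ∀ i j,
      0 ≤ y i j + t * C i j := by
    intro t ht hp hq hr i j
    have hn := hy.nonneg i j
    by_cases a1 : j = p ∧ i = S
    · rw [a1.1, a1.2, e2]; linarith
    by_cases a2 : j = q ∧ i = T
    · rw [a2.1, a2.2, e3]; linarith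
    by_cases a3 : j = r ∧ i = R
    · rw [a3.1, a3.2, e4]; linarith
    have := mul_nonneg ht (hpos i j a1 a2 a3)
    linarith
  have hz : ZeroMargin C := zeroMargin_three p q r R S T
  have c1 : y S p ≤ y T q → y S p ≤ y R r → CanPivot u v y (R, p) (S, p) := fun a b =>
    hy.exists_isPivot hg hz h1 e1 h2 e2 hs (hm _ h2.le le_rfl a b)
  have c2 : y T q ≤ y S p → y T q ≤ y R r → CanPivot u v y (R, p) (T, q) := fun a b =>
    hy.exists_isPivot hg hz h1 e1 h4 e3 hs (hm _ h4.le a le_rfl b)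
  have c3 : y R r ≤ y S p → y R r ≤ y T q → CanPivot u v y (R, p) (R, r) := fun a b =>
    hy.exists_isPivot hg hz h1 e1 h6 e4 hs (hm _ h6.le a b le_rfl)
  rcases le_total (y S p) (y T q) with h | h
  · rcases le_total (y S p) (y R r) with h' | h'
    · exact Or.inl ⟨c1 h h', h, h'⟩
    · exact Or.inr (Or.inr ⟨c3 h' (h'.trans h), h', h'.trans h⟩)
  · rcases le_total (y T q) (y R r) with h' | h'
    · exact Or.inr (Or.inl ⟨c2 h h', h, h'⟩)
    · exact Or.inr (Or.inr ⟨c3 (h'.trans h) h', h'.trans h, h'⟩)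

end Basic

/-! ### Flows towards a target -/

/-- If `π j` is the row meant to serve the column `j`, the amount that row `R` ships to columns
meant for row `S`. -/
noncomputable def flow (π : Fin n → Fin 3) (y : Matrix (Fin 3) (Fin n) ℝ) (R S : Fin 3) : ℝ :=
  ∑ j with π j = S, y R j

/-- The amount by which the margin of row `R` exceeds the demand of the columns meant for it. -/
noncomputable def excess (u : Fin 3 → ℝ) (v : Fin n → ℝ) (π : Fin n → Fin 3) (R : Fin 3) : ℝ :=
  u R - ∑ j with π j = R, v j

section Flow

variable {u : Fin 3 → ℝ} {v : Fin n → ℝ} {y : Matrix (Fin 3) (Fin n) ℝ} {π : Fin n → Fin 3}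

theorem IsBasic.flow_nonneg (hy : IsBasic u v y) (R S : Fin 3) : 0 ≤ flow π y R S :=
  sum_nonneg fun _ _ => hy.nonneg _ _

theorem IsBasic.le_flow (hy : IsBasic u v y) {j : Fin n} {S : Fin 3} (R : Fin 3) (h : π j = S) :
    y R j ≤ flow π y R S :=
  single_le_sum (f := fun j => y R j) (fun _ _ => hy.nonneg _ _) (by simpa using h)

/-- The form of `IsBasic.le_flow` suited to automation. -/
theorem IsBasic.le_flow' (hy : IsBasic u v y) (R : Fin 3) (j : Fin n) :
    y R j ≤ flow π y R (π j) :=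
  hy.le_flow R rfl

theorem IsBasic.add_le_flow (hy : IsBasic u v y) {j k : Fin n} {S : Fin 3} (R : Fin 3)
    (hjk : j ≠ k) (hj : π j = S) (hk : π k = S) : y R j + y R k ≤ flow π y R S := by
  rw [← sum_pair (f := fun j => y R j) hjk]
  refine sum_le_sum_of_subset_of_nonneg ?_ fun _ _ _ => hy.nonneg _ _
  intro i hi
  rw [mem_insert, mem_singleton] at hi
  rcases hi with rfl | rfl <;> simpa

theorem IsBasic.flow_eq_zero_iff (hy : IsBasic u v y) {R S : Fin 3} :
    flow π y R S = 0 ↔ ∀ j, π j = S → y R j = 0 := by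
  rw [flow, sum_eq_zero_iff_of_nonneg fun _ _ => hy.nonneg _ _]
  simp

theorem IsBasic.exists_of_flow_ne (hy : IsBasic u v y) {R S : Fin 3} (h : flow π y R S ≠ 0) :
    ∃ j, π j = S ∧ 0 < y R j := by
  rw [Ne, hy.flow_eq_zero_iff] at h
  push Not at h
  obtain ⟨j, h1, h2⟩ := h
  exact ⟨j, h1, (hy.pos_or_zero R j).resolve_right h2⟩

/-- The net outflow of a row depends only on the margins. -/
theorem IsBasic.balance (hy : IsBasic u v y) {X Y Z : Fin 3} (h : RowLabelling X Y Z) :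
    flow π y X Y + flow π y X Z - flow π y Y X - flow π y Z X = excess u v π X := by
  have h1 : flow π y X X + flow π y X Y + flow π y X Z = u X := by
    rw [← h.sum_eq (fun S => flow π y X S), ← hy.row X]
    exact sum_fiberwise univ π fun j => y X j
  have h2 : flow π y X X + flow π y Y X + flow π y Z X = ∑ j with π j = X, v j := by
    rw [← h.sum_eq (fun R => flow π y R X)]
    refine (sum_comm (s := univ) (t := univ.filter fun j => π j = X)
      (f := fun i j => y i j)).trans ?_
    exact sum_congr rfl fun j _ => hy.col j
  rw [excess]
  linarith

end Flow

/-- Some pivot brings in a cell from `I` and removes a cell outside `K`. -/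
def Improvable (u : Fin 3 → ℝ) (v : Fin n → ℝ) (y : Matrix (Fin 3) (Fin n) ℝ)
    (I K : Fin 3 → Fin n → Prop) : Prop :=
  ∃ e r, I e.1 e.2 ∧ ¬ K r.1 r.2 ∧ CanPivot u v y e r

section Improve

variable {u : Fin 3 → ℝ} {v : Fin n → ℝ} {y : Matrix (Fin 3) (Fin n) ℝ}
  {I K : Fin 3 → Fin n → Prop}

/-- A pivot along a cycle through two columns: the decreasing cells are `(S, p)` and `(R, q)`, and
one that belongs to `K` is not the smaller one. -/
theorem IsBasic.improve_two (hy : IsBasic u v y) (hg : Generic u v) (R S : Fin 3) (p q : Fin n)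
    (h : p ≠ q ∧ R ≠ S ∧ y R p = 0 ∧ 0 < y S p ∧ 0 < y S q ∧ 0 < y R q ∧ I R p ∧
      (¬ K S p ∨ y R q < y S p) ∧ (¬ K R q ∨ y S p < y R q)) : Improvable u v y I K := by
  obtain ⟨h1, h2, h3, h4, h5, h6, h7, h8, h9⟩ := h
  rcases hy.pivot_two hg h1 h2 h3 h4 h5 h6 with ⟨k, l⟩ | ⟨k, l⟩
  · exact ⟨_, _, h7, h8.resolve_right l.not_gt, k⟩
  · exact ⟨_, _, h7, h9.resolve_right l.not_gt, k⟩

/-- A pivot along a cycle through three columns: the decreasing cells are `(S, p)`, `(T, q)` and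
`(R, r)`, and one that belongs to `K` is not the smallest one. -/
theorem IsBasic.improve_three (hy : IsBasic u v y) (hg : Generic u v) (R S T : Fin 3)
    (p q r : Fin n)
    (h : RowLabelling R S T ∧ p ≠ q ∧ p ≠ r ∧ q ≠ r ∧ y R p = 0 ∧ 0 < y S p ∧ 0 < y S q ∧
      0 < y T q ∧ 0 < y T r ∧ 0 < y R r ∧ I R p ∧
      (¬ K S p ∨ y T q < y S p ∨ y R r < y S p) ∧ (¬ K T q ∨ y S p < y T q ∨ y R r < y T q) ∧
      (¬ K R r ∨ y S p < y R r ∨ y T q < y R r)) : Improvable u v y I K := by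
  obtain ⟨hL, h1, h2, h3, h4, h5, h6, h7, h8, h9, h10, h11, h12, h13⟩ := h
  rcases hy.pivot_three hg hL h1 h2 h3 h4 h5 h6 h7 h8 h9 with ⟨k, l, m⟩ | ⟨k, l, m⟩ | ⟨k, l, m⟩
  · exact ⟨_, _, h10, h11.resolve_right (not_or.2 ⟨l.not_gt, m.not_gt⟩), k⟩
  · exact ⟨_, _, h10, h12.resolve_right (not_or.2 ⟨l.not_gt, m.not_gt⟩), k⟩
  · exact ⟨_, _, h10, h13.resolve_right (not_or.2 ⟨l.not_gt, m.not_gt⟩), k⟩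

end Improve

/-- The cells of a target: those prescribed by `π`, and the cells `(B, c)` and `(C, d)`. -/
def InTarget (π : Fin n → Fin 3) (B C : Fin 3) (c d : Fin n) (R : Fin 3) (j : Fin n) : Prop :=
  π j = R ∨ (R = B ∧ j = c) ∨ (R = C ∧ j = d)

/-! ### Steps towards a path -/

/-- Numerical data of a target whose support is a path `A - c - B - d - C` with leaf columns, the
column `j` being served by row `π j`, and the cells `(B, c)` and `(C, d)` carrying `α` and `β`. -/
structure PathTarget (u : Fin 3 → ℝ) (v : Fin n → ℝ) (π : Fin n → Fin 3) (A B C : Fin 3)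
    (c d : Fin n) (α β : ℝ) : Prop where
  lab : RowLabelling A B C
  hc : π c = A
  hd : π d = B
  α_pos : 0 < α
  β_pos : 0 < β
  α_lt : α < v c
  β_lt : β < v d
  exA : excess u v π A = -α
  exB : excess u v π B = α - β
  exC : excess u v π C = β

section Path

variable {u : Fin 3 → ℝ} {v : Fin n → ℝ} {y : Matrix (Fin 3) (Fin n) ℝ} {π : Fin n → Fin 3}
  {A B C : Fin 3} {c d : Fin n} {α β : ℝ}

/-- The case of arcs `C → B`, `C → A` and `B → A` only. The cells of row `A`, and those of row `B`
outside the columns of `A`, then lie in the target, so it remains to avoid that they leave: they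
are large, as `v c` and `v d` exceed the total flow into `A` and out of `C`. -/
theorem PathTarget.improve_CBA (ht : PathTarget u v π A B C c d α β) (hg : Generic u v)
    (hy : IsBasic u v y) (hAB : flow π y A B = 0) (hAC : flow π y A C = 0)
    (hBC : flow π y B C = 0) (hm : ∃ R j, InTarget π B C c d R j ∧ y R j = 0) :
    Improvable u v y (InTarget π B C c d) (InTarget π B C c d) := by
  obtain ⟨hL, hc, hd, hα, hβ, hαc, hβd, exA, exB, exC⟩ := ht
  have bA := hy.balance (π := π) hL
  have bC := hy.balance (π := π) hL.rev
  have nCA := hy.flow_nonneg (π := π) C A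
  have cc := hy.col_eq hL c
  have cd := hy.col_eq hL d
  have zAB := hy.flow_eq_zero_iff.1 hAB
  have zAC := hy.flow_eq_zero_iff.1 hAC
  have zBC := hy.flow_eq_zero_iff.1 hBC
  have hAd : y A d = 0 := zAB d hd
  have fA : ∀ j, 0 < y A j → π j = A := by
    intro j hj
    rcases hL.eq_or (π j) with h | h | h
    exacts [h, absurd (zAB j h) hj.ne', absurd (zAC j h) hj.ne']
  have fB : ∀ j, 0 < y B j → π j = A ∨ π j = B := by
    intro j hj
    rcases hL.eq_or (π j) with h | h | h
    exacts [Or.inl h, Or.inr h, absurd (zBC j h) hj.ne']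
  have lf := hy.le_flow' (π := π)
  rcases hy.pos_or_zero C d with hCd | hCd
  · have hdp : ∀ p, 0 < y A p → d ≠ p := by grind
    rcases hy.classify hg hL with ⟨p, h⟩ | ⟨p, q, h⟩ | ⟨p, q, h⟩ | ⟨p, q, h⟩
    · have lu := h.unique
      obtain ⟨fl, -⟩ := h
      grind
    · have lu := h.unique
      obtain ⟨-, hpq, xp, yp, zp, xq, yq, zq, hl⟩ := h
      have hp := fA _ xp
      obtain rfl : d = q := by
        by_contra hdq
        grind
      rcases eq_or_ne c p with rfl | hcp
      -- `(B, c)` and `(C, d)` are in the support: a missing cell `(π j, j)` enters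
      · obtain ⟨R, j, hR, hj⟩ := hm
        have hjR : π j = R := by grind [InTarget]
        obtain ⟨S, hS, hS'⟩ := hl j (by grind) (by grind)
        have hSA : S ≠ A := by grind
        have := fun h => hy.add_le_flow (π := π) (j := j) (k := c) S (by grind) h hc
        have := fun h => hy.add_le_flow (π := π) (j := j) (k := d) S (by grind) h hd
        rcases (hL.eq_or S) with rfl | rfl | rfl
        · exact absurd rfl hSA
        · exact hy.improve_two hg A S j c (by grind [InTarget])
        · rcases (hL.eq_or R) with rfl | rfl | rfl
          · exact hy.improve_three hg R S B j d c (by grind [InTarget, RowLabelling])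
          · exact hy.improve_two hg R S j d (by grind [InTarget])
          · grind
      · have := hy.le_flow B hp
        exact hy.improve_two hg B A c p (by grind [InTarget])
    · have lu := h.unique
      obtain ⟨-, hpq, xp, yp, zp, xq, yq, zq, hl⟩ := h
      grind
    · have lu := h.unique
      obtain ⟨-, hpq, xp, yp, zp, xq, yq, zq, hl⟩ := h
      obtain rfl : d = q := by
        by_contra hdq
        grind
      rcases eq_or_ne c p with rfl | hcp
      · exact hy.improve_two hg B C c d (by grind [InTarget])
      · exact hy.improve_three hg B A C c p d (by grind [InTarget, RowLabelling])
  · rcases hy.classify hg hL with ⟨p, h⟩ | ⟨p, q, h⟩ | ⟨p, q, h⟩ | ⟨p, q, h⟩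
    · have hp : π p = A := fA _ (h.full _)
      have := h.full
      exact hy.improve_two hg C B d p (by grind [InTarget])
    · have lu := h.unique
      obtain ⟨-, hpq, xp, yp, zp, xq, yq, zq, hl⟩ := h
      exact hy.improve_two hg C B d q (by grind [InTarget])
    · have lu := h.unique
      obtain ⟨-, hpq, xp, yp, zp, xq, yq, zq, hl⟩ := h
      rcases eq_or_ne c p with rfl | hcp
      · exact hy.improve_three hg C B A d c q (by grind [InTarget, RowLabelling])
      -- here `(C, d)` might drive out `(A, p)`, so `(B, c)` enters instead
      · have hcB := hy.le_flow B hc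
        have : y B c = 0 := by
          grind
        exact hy.improve_two hg B A c p (by grind [InTarget])
    · have lu := h.unique
      obtain ⟨-, hpq, xp, yp, zp, xq, yq, zq, hl⟩ := h
      exact hy.improve_two hg C B d q (by grind [InTarget])

/-- The case of arcs `C → A`, `C → B` and `A → B` only, the last one being present. The cell
`(B, c)`, which is not in the support, must not enter: it would close the cycle `A → B → A`. -/
theorem PathTarget.improve_CAB (ht : PathTarget u v π A B C c d α β) (hg : Generic u v)
    (hy : IsBasic u v y) (hAC : flow π y A C = 0) (hBA : flow π y B A = 0)
    (hBC : flow π y B C = 0) (hAB : flow π y A B ≠ 0) :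
    Improvable u v y (fun R j => π j = R ∨ (R = C ∧ j = d)) (InTarget π B C c d) := by
  obtain ⟨hL, hc, hd, hα, hβ, hαc, hβd, exA, exB, exC⟩ := ht
  have bA := hy.balance (π := π) hL
  have bC := hy.balance (π := π) hL.rev
  have nn := fun R S => hy.flow_nonneg (π := π) R S
  have cd := hy.col_eq hL d
  have lf := hy.le_flow' (π := π)
  have nAB := nn A B
  have zAC := hy.flow_eq_zero_iff.1 hAC
  have zBA := hy.flow_eq_zero_iff.1 hBA
  have zBC := hy.flow_eq_zero_iff.1 hBC
  have fA : ∀ j, 0 < y A j → π j = A ∨ π j = B := by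
    intro j hj
    rcases hL.eq_or (π j) with h | h | h
    exacts [Or.inl h, Or.inr h, absurd (zAC j h) hj.ne']
  have fB : ∀ j, 0 < y B j → π j = B := by
    intro j hj
    rcases hL.eq_or (π j) with h | h | h
    exacts [absurd (zBA j h) hj.ne', h, absurd (zBC j h) hj.ne']
  obtain ⟨k, hk, hCk⟩ := hy.exists_of_flow_ne (R := C) (S := A) (by linarith)
  obtain ⟨l, hl, hAl⟩ := hy.exists_of_flow_ne hAB
  rcases hy.pos_or_zero C d with hCd | hCd
  · rcases hy.classify hg hL with ⟨p, h⟩ | ⟨p, q, h⟩ | ⟨p, q, h⟩ | ⟨p, q, h⟩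
    · have lu := h.unique
      have fl := h.full
      obtain rfl : d = p := by
        by_contra hdp
        grind
      exact hy.improve_two hg A C k d (by grind [InTarget])
    · have lu := h.unique
      obtain ⟨-, hpq, xp, yp, zp, xq, yq, zq, -⟩ := h
      obtain rfl : d = q := by
        by_contra hdq
        grind
      exact hy.improve_three hg A C B k d p (by grind [InTarget, RowLabelling])
    · have lu := h.unique
      obtain ⟨-, hpq, xp, yp, zp, xq, yq, zq, -⟩ := h
      grind
    · have lu := h.unique
      obtain ⟨-, hpq, xp, yp, zp, xq, yq, zq, -⟩ := h
      obtain rfl : d = q := by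
        by_contra hdq
        grind
      rcases fA p xp with hp | hp
      · exact hy.improve_three hg B A C l p d (by grind [InTarget, RowLabelling])
      · have := hy.add_le_flow C hpq hp hd
        exact hy.improve_two hg B C p d (by grind [InTarget])
  · rcases hy.classify hg hL with ⟨p, h⟩ | ⟨p, q, h⟩ | ⟨p, q, h⟩ | ⟨p, q, h⟩
    · have lu := h.unique
      have fl := h.full
      exact hy.improve_two hg C B d p (by grind [InTarget])
    · have lu := h.unique
      obtain ⟨-, hpq, xp, yp, zp, xq, yq, zq, -⟩ := h
      exact hy.improve_two hg C B d q (by grind [InTarget])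
    · have lu := h.unique
      obtain ⟨-, hpq, xp, yp, zp, xq, yq, zq, -⟩ := h
      rcases eq_or_ne d p with rfl | hdp
      · exact hy.improve_two hg C A d q (by grind [InTarget])
      · exact hy.improve_three hg C B A d p q (by grind [InTarget, RowLabelling])
    · have lu := h.unique
      obtain ⟨-, hpq, xp, yp, zp, xq, yq, zq, -⟩ := h
      exact hy.improve_two hg C B d q (by grind [InTarget])

/-- The case of arcs `B → C`, `B → A` and `C → A` only, the first one being present. The cell
`(C, d)`, which is not in the support, must not enter: it would close the cycle `B → C → B`. -/
theorem PathTarget.improve_BCA (ht : PathTarget u v π A B C c d α β) (hg : Generic u v)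
    (hy : IsBasic u v y) (hAB : flow π y A B = 0) (hAC : flow π y A C = 0)
    (hCB : flow π y C B = 0) (hBC : flow π y B C ≠ 0) :
    Improvable u v y (fun R j => π j = R ∨ (R = B ∧ j = c)) (InTarget π B C c d) := by
  obtain ⟨hL, hc, hd, hα, hβ, hαc, hβd, exA, exB, exC⟩ := ht
  have bA := hy.balance (π := π) hL
  have bC := hy.balance (π := π) hL.rev
  have nn := fun R S => hy.flow_nonneg (π := π) R S
  have cc := hy.col_eq hL c
  have lf := hy.le_flow' (π := π)
  have nBC := nn B C
  have zAB := hy.flow_eq_zero_iff.1 hAB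
  have zAC := hy.flow_eq_zero_iff.1 hAC
  have zCB := hy.flow_eq_zero_iff.1 hCB
  have fA : ∀ j, 0 < y A j → π j = A := by
    intro j hj
    rcases hL.eq_or (π j) with h | h | h
    exacts [h, absurd (zAB j h) hj.ne', absurd (zAC j h) hj.ne']
  have fC : ∀ j, 0 < y C j → π j = A ∨ π j = C := by
    intro j hj
    rcases hL.eq_or (π j) with h | h | h
    exacts [Or.inl h, absurd (zCB j h) hj.ne', Or.inr h]
  obtain ⟨k, hk, hCk⟩ := hy.exists_of_flow_ne (R := C) (S := A) (by
    intro h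
    linarith)
  obtain ⟨l, hl, hBl⟩ := hy.exists_of_flow_ne hBC
  rcases hy.pos_or_zero B c with hBc | hBc
  · rcases hy.classify hg hL with ⟨p, h⟩ | ⟨p, q, h⟩ | ⟨p, q, h⟩ | ⟨p, q, h⟩
    · have lu := h.unique
      have fl := h.full
      obtain rfl : c = p := by
        by_contra hcp
        grind
      exact hy.improve_two hg C B l c (by grind [InTarget])
    · have lu := h.unique
      obtain ⟨-, hpq, xp, yp, zp, xq, yq, zq, -⟩ := h
      obtain rfl : c = p := by
        by_contra hcp
        grind
      rcases fC q zq with hq | hq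
      · have := hy.add_le_flow B hpq hc hq
        exact hy.improve_two hg A B q c (by grind [InTarget])
      · exact hy.improve_three hg A C B k q c (by grind [InTarget, RowLabelling])
    · have lu := h.unique
      obtain ⟨-, hpq, xp, yp, zp, xq, yq, zq, -⟩ := h
      obtain rfl : c = p := by
        by_contra hcp
        grind
      exact hy.improve_three hg C B A l c q (by grind [InTarget, RowLabelling])
    · have lu := h.unique
      obtain ⟨-, hpq, xp, yp, zp, xq, yq, zq, -⟩ := h
      grind
  · rcases hy.classify hg hL with ⟨p, h⟩ | ⟨p, q, h⟩ | ⟨p, q, h⟩ | ⟨p, q, h⟩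
    · have lu := h.unique
      have fl := h.full
      exact hy.improve_two hg B A c p (by grind [InTarget])
    · have lu := h.unique
      obtain ⟨-, hpq, xp, yp, zp, xq, yq, zq, -⟩ := h
      exact hy.improve_two hg B A c p (by grind [InTarget])
    · have lu := h.unique
      obtain ⟨-, hpq, xp, yp, zp, xq, yq, zq, -⟩ := h
      exact hy.improve_two hg B A c p (by grind [InTarget])
    · have lu := h.unique
      obtain ⟨-, hpq, xp, yp, zp, xq, yq, zq, -⟩ := h
      rcases eq_or_ne c p with rfl | hcp
      · exact hy.improve_two hg B C c q (by grind [InTarget])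
      · exact hy.improve_three hg B A C c p q (by grind [InTarget, RowLabelling])

end Path

/-! ### Steps towards a star -/

/-- Numerical data of a target whose support is the full column `c` with leaf columns, the column
`j` being served by row `π j`, and the cells `(B, c)` and `(C, c)` carrying `α` and `β`. -/
structure StarTarget (u : Fin 3 → ℝ) (v : Fin n → ℝ) (π : Fin n → Fin 3) (A B C : Fin 3)
    (c : Fin n) (α β : ℝ) : Prop where
  lab : RowLabelling A B C
  hc : π c = A
  α_pos : 0 < α
  β_pos : 0 < β
  lt : α + β < v c
  exA : excess u v π A = -(α + β)
  exB : excess u v π B = α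
  exC : excess u v π C = β

section Star

variable {u : Fin 3 → ℝ} {v : Fin n → ℝ} {y : Matrix (Fin 3) (Fin n) ℝ} {π : Fin n → Fin 3}
  {A B C : Fin 3} {c : Fin n} {α β : ℝ}

theorem StarTarget.swap (ht : StarTarget u v π A B C c α β) : StarTarget u v π A C B c β α :=
  ⟨ht.lab.swap', ht.hc, ht.β_pos, ht.α_pos, add_comm α β ▸ ht.lt, add_comm α β ▸ ht.exA, ht.exC,
    ht.exB⟩

/-- If `c` is the only column of `A` to which `B` ships, it carries the whole flow. -/
theorem flow_eq_single (hc : π c = A) (h : ∀ j, j ≠ c → π j = A → y B j = 0) :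
    flow π y B A = y B c :=
  sum_eq_single c (fun j hj hjc => h j hjc (by simpa using hj)) (by simp [hc])

/-- The case of arcs `C → B`, `C → A` and `B → A` only. Cells of row `B` in columns of `A` other
than `c` are removed with priority: when none is left, `(B, c)` carries the whole flow from `B` to
`A`, so it is larger than the flow from `C` to `B` and does not leave. -/
theorem StarTarget.improve_CBA (ht : StarTarget u v π A B C c α β) (hg : Generic u v)
    (hy : IsBasic u v y) (hAB : flow π y A B = 0) (hAC : flow π y A C = 0)
    (hBC : flow π y B C = 0) (hm : ∃ R j, InTarget π B C c c R j ∧ y R j = 0) :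
    Improvable u v y (InTarget π B C c c) (InTarget π B C c c) := by
  obtain ⟨hL, hc, hα, hβ, hαc, exA, exB, exC⟩ := ht
  have bA := hy.balance (π := π) hL
  have bC := hy.balance (π := π) hL.rev
  have nCB := hy.flow_nonneg (π := π) C B
  have cc := hy.col_eq hL c
  have lf := hy.le_flow' (π := π)
  have zAB := hy.flow_eq_zero_iff.1 hAB
  have zAC := hy.flow_eq_zero_iff.1 hAC
  have zBC := hy.flow_eq_zero_iff.1 hBC
  have fA : ∀ j, 0 < y A j → π j = A := by
    intro j hj
    rcases hL.eq_or (π j) with h | h | h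
    exacts [h, absurd (zAB j h) hj.ne', absurd (zAC j h) hj.ne']
  have fB : ∀ j, 0 < y B j → π j = A ∨ π j = B := by
    intro j hj
    rcases hL.eq_or (π j) with h | h | h
    exacts [Or.inl h, Or.inr h, absurd (zBC j h) hj.ne']
  rcases hy.pos_or_zero C c with hCc | hCc
  · rcases hy.classify hg hL with ⟨p, h⟩ | ⟨p, q, h⟩ | ⟨p, q, h⟩ | ⟨p, q, h⟩
    · have lu := h.unique
      obtain ⟨fl, hl⟩ := h
      obtain rfl : c = p := by
        by_contra hcp
        grind
      by_cases hex : ∃ j, j ≠ c ∧ π j = A ∧ 0 < y B j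
      · obtain ⟨j, hjc, hj, hBj⟩ := hex
        have := hy.add_le_flow B hjc hj hc
        exact hy.improve_two hg A B j c (by grind [InTarget])
      · have hBA : flow π y B A = y B c := flow_eq_single hc fun j hjc hj =>
          (hy.pos_or_zero B j).resolve_left fun h => hex ⟨j, hjc, hj, h⟩
        obtain ⟨R, j, hR, hj⟩ := hm
        have hjR : π j = R := by grind [InTarget]
        have hjc : j ≠ c := by grind
        obtain ⟨S, hS, hS'⟩ := hl j hjc
        have hjA := fun h => hy.add_le_flow (π := π) C hjc h hc
        obtain rfl : S = C := by
          rcases hL.eq_or S with rfl | rfl | rfl <;> grind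
        rcases hL.eq_or R with rfl | rfl | rfl
        · exact hy.improve_two hg R S j c (by grind [InTarget])
        · exact hy.improve_two hg R S j c (by grind [InTarget])
        · grind
    · have lu := h.unique
      obtain ⟨-, hpq, xp, yp, zp, xq, yq, zq, -⟩ := h
      grind
    · have lu := h.unique
      obtain ⟨-, hpq, xp, yp, zp, xq, yq, zq, -⟩ := h
      obtain rfl : c = q := by
        by_contra hcp
        grind
      exact hy.improve_two hg B A c p (by grind [InTarget])
    · have lu := h.unique
      obtain ⟨-, hpq, xp, yp, zp, xq, yq, zq, -⟩ := h
      obtain rfl : c = p := by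
        by_contra hcp
        grind
      rcases fB q zq with hq | hq
      · have := hy.add_le_flow C hpq hc hq
        exact hy.improve_two hg A C q c (by grind [InTarget])
      · obtain ⟨j, hj, hBj⟩ := hy.exists_of_flow_ne (R := B) (S := A) (by
          intro h
          linarith)
        exact hy.improve_three hg A B C j q c (by grind [InTarget, RowLabelling])
  · rcases hy.classify hg hL with ⟨p, h⟩ | ⟨p, q, h⟩ | ⟨p, q, h⟩ | ⟨p, q, h⟩
    · have lu := h.unique
      have fl := h.full
      exact hy.improve_two hg C A c p (by grind [InTarget])
    · have lu := h.unique
      obtain ⟨-, hpq, xp, yp, zp, xq, yq, zq, -⟩ := h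
      rcases eq_or_ne c p with rfl | hcp
      · by_cases hex : ∃ j, j ≠ c ∧ π j = A ∧ 0 < y B j
        · obtain ⟨j, hjc, hj, hBj⟩ := hex
          have := hy.add_le_flow B hjc hj hc
          exact hy.improve_two hg A B j c (by grind [InTarget])
        · have hBA : flow π y B A = y B c := flow_eq_single hc fun j hjc hj =>
            (hy.pos_or_zero B j).resolve_left fun h => hex ⟨j, hjc, hj, h⟩
          exact hy.improve_two hg C B c q (by grind [InTarget])
      · exact hy.improve_three hg C A B c p q (by grind [InTarget, RowLabelling])
    · have lu := h.unique
      obtain ⟨-, hpq, xp, yp, zp, xq, yq, zq, -⟩ := h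
      exact hy.improve_two hg C A c q (by grind [InTarget])
    · have lu := h.unique
      obtain ⟨-, hpq, xp, yp, zp, xq, yq, zq, -⟩ := h
      exact hy.improve_two hg C A c p (by grind [InTarget])

end Star

/-! ### Acyclic flow patterns -/

/-- The arcs `R → S` with positive flow form an acyclic digraph. -/
def Acyclic (π : Fin n → Fin 3) (y : Matrix (Fin 3) (Fin n) ℝ) : Prop :=
  ∃ X Y Z, RowLabelling X Y Z ∧ flow π y Z Y = 0 ∧ flow π y Z X = 0 ∧ flow π y Y X = 0

section

variable {u : Fin 3 → ℝ} {v : Fin n → ℝ} {y y' : Matrix (Fin 3) (Fin n) ℝ} {π : Fin n → Fin 3}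
  {e r : Fin 3 × Fin n}

/-- A pivot creates no flow from `R` to `S`, unless the entering cell ships from `R` to `S`. -/
theorem IsPivot.flow_eq_zero (h : IsPivot u v y e r y') (hy : IsBasic u v y) {R S : Fin 3}
    (he : e.1 ≠ R ∨ π e.2 ≠ S) (h0 : flow π y R S = 0) : flow π y' R S = 0 := by
  rw [h.basic.flow_eq_zero_iff]
  intro j hj
  refine (h.basic.pos_or_zero R j).resolve_left fun hpos => ?_
  have hmem : (R, j) ∈ supp y' := by simpa using hpos
  rw [h.supp_eq, mem_insert, mem_erase, mem_supp] at hmem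
  rcases hmem with rfl | ⟨-, hmem⟩
  · rcases he with he | he
    exacts [he rfl, he hj]
  · exact hmem.ne' (hy.flow_eq_zero_iff.1 h0 j hj)

theorem IsPivot.pos_enter (h : IsPivot u v y e r y') : 0 < y' e.1 e.2 := by
  rw [← mem_supp, h.supp_eq]
  exact mem_insert_self _ _

theorem IsPivot.pos_of_ne (h : IsPivot u v y e r y') {R : Fin 3} {j : Fin n}
    (hR : 0 < y R j) (hne : r ≠ (R, j)) : 0 < y' R j := by
  have : (R, j) ∈ supp y' := by
    rw [h.supp_eq]
    exact mem_insert_of_mem (mem_erase.2 ⟨hne.symm, by simpa using hR⟩)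
  simpa using this

theorem exists_labelling (Z : Fin 3) : ∃ X Y, RowLabelling X Y Z := by
  refine ⟨Z + 1, Z + 2, ?_, ?_, ?_⟩ <;> revert Z <;> decide

/-- If no pivot trades a cell prescribed by `π` for another cell, and the flow pattern has a
cycle, then the support is a path whose middle row is a source or a sink of the flow. -/
theorem IsBasic.acyclic_or_of_not_improvable (hy : IsBasic u v y) (hg : Generic u v)
    (hst : ¬ Improvable u v y (fun R j => π j = R) (fun R j => π j = R)) :
    Acyclic π y ∨ ∃ X Y Z p q, IsPath y X Y Z p q ∧
      ((π p = X ∧ π q = Z ∧ flow π y X Y = 0 ∧ flow π y Z Y = 0) ∨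
        (flow π y Y X = 0 ∧ flow π y Y Z = 0)) := by
  -- a missing arc is shown by a pivot in which no decreasing cell is prescribed by `π`
  have key : ∀ {X Y Z : Fin 3} {p q : Fin n}, IsPath y X Y Z p q →
      (π p ≠ Y → flow π y X Y = 0) ∧ (π p ≠ X → flow π y Y X = 0) ∧
        (π p ≠ Y → π q ≠ Z → flow π y X Z = 0) := by
    intro X Y Z p q h
    have lu := h.unique
    obtain ⟨⟨hxy, hxz, hyz⟩, hpq, xp, yp, zp, xq, yq, zq, -⟩ := h
    refine ⟨fun h1 => ?_, fun h1 => ?_, fun h1 h2 => ?_⟩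
    · refine hy.flow_eq_zero_iff.2 fun j hj => (hy.pos_or_zero _ _).resolve_left fun hpos => ?_
      exact hst (hy.improve_two hg Y X j p (by grind))
    · refine hy.flow_eq_zero_iff.2 fun j hj => (hy.pos_or_zero _ _).resolve_left fun hpos => ?_
      exact hst (hy.improve_two hg X Y j p (by grind))
    · refine hy.flow_eq_zero_iff.2 fun j hj => (hy.pos_or_zero _ _).resolve_left fun hpos => ?_
      by_cases hjp : j = p
      · exact hst (hy.improve_two hg Z Y p q (by grind))
      · exact hst (hy.improve_three hg Z X Y j p q (by grind [RowLabelling]))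
  have path : ∀ {X Y Z : Fin 3} {p q : Fin n}, IsPath y X Y Z p q → Acyclic π y ∨
      ∃ X Y Z p q, IsPath y X Y Z p q ∧
      ((π p = X ∧ π q = Z ∧ flow π y X Y = 0 ∧ flow π y Z Y = 0) ∨
        (flow π y Y X = 0 ∧ flow π y Y Z = 0)) := by
    intro X Y Z p q h
    obtain ⟨xy, yx, xz⟩ := key h
    obtain ⟨zy, yz, zx⟩ := key h.rev
    have hL := h.lab
    have hxy := hL.xy
    have hxz := hL.xz
    have hyz := hL.yz
    rcases hL.eq_or (π p) with hp | hp | hp <;> rcases hL.eq_or (π q) with hq | hq | hq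
    · exact Or.inl ⟨Y, Z, X, hL.swap.swap', by grind⟩
    · exact Or.inl ⟨Z, Y, X, hL.rev, by grind⟩
    · exact Or.inr ⟨X, Y, Z, p, q, h, by grind⟩
    · exact Or.inl ⟨X, Y, Z, hL, by grind⟩
    · exact Or.inr ⟨X, Y, Z, p, q, h, by grind⟩
    · exact Or.inl ⟨X, Y, Z, hL, by grind⟩
    · exact Or.inl ⟨X, Y, Z, hL, by grind⟩
    · exact Or.inl ⟨Z, Y, X, hL.rev, by grind⟩
    · exact Or.inl ⟨X, Y, Z, hL, by grind⟩
  have hL : RowLabelling 0 1 2 := by constructor <;> decide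
  rcases hy.classify hg hL with ⟨p, h⟩ | ⟨p, q, h⟩ | ⟨p, q, h⟩ | ⟨p, q, h⟩
  · have lu := h.unique
    have fl := h.full
    have zero : ∀ R S, R ≠ S → S ≠ π p → flow π y R S = 0 := fun R S hRS hS =>
      hy.flow_eq_zero_iff.2 fun j hj => (hy.pos_or_zero _ _).resolve_left fun hpos =>
        hst (hy.improve_two hg S R j p (by grind))
    obtain ⟨X, Y, hXY⟩ := exists_labelling (π p)
    exact Or.inl ⟨X, Y, π p, hXY, zero _ _ hXY.yz.symm hXY.yz, zero _ _ hXY.xz.symm hXY.xz,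
      zero _ _ hXY.xy.symm hXY.xz⟩
  exacts [path h, path h, path h]

/-! ### A row that is a sink or a source of the flow -/

/-- If row `Y` is a sink and the target cell `(Z, κ)` of a column meant for `Y` is not in the
support, it can enter without loss: the bound on `v κ` makes `(Y, κ)` exceed the flow into `Y`. -/
theorem IsBasic.enter_of_sink (hy : IsBasic u v y) (hg : Generic u v) {X Y Z : Fin 3}
    {p q κ : Fin n} (h : IsPath y X Y Z p q) (hκ : π κ = Y) (hYX : flow π y Y X = 0)
    (hYZ : flow π y Y Z = 0) (hlt : -excess u v π Y < v κ) (h0 : y Z κ = 0) :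
    Improvable u v y (fun R j => R = Z ∧ j = κ) (fun R j => π j = R) := by
  have b := hy.balance (π := π) h.lab.swap
  have lf := hy.le_flow' (π := π)
  have cc := hy.col_eq h.lab κ
  have zYX := hy.flow_eq_zero_iff.1 hYX
  have zYZ := hy.flow_eq_zero_iff.1 hYZ
  obtain ⟨⟨hxy, hxz, hyz⟩, hpq, xp, yp, zp, xq, yq, zq, -⟩ := h
  have hq : π q = Y := by
    rcases (RowLabelling.mk hxy hxz hyz).eq_or (π q) with h | h | h
    exacts [absurd (zYX q h) yq.ne', h, absurd (zYZ q h) yq.ne']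
  exact hy.improve_two hg Z Y κ q (by grind)

/-- If row `Y` is a sink, the target cell `(Z, κ)` of a column meant for `Y` is in the support, and
the arcs `X → Z` and `Z → X` form a cycle, then a cell prescribed by `π` can enter while `(Z, κ)`
and all cells prescribed by `π` stay. -/
theorem IsBasic.improve_of_sink (hy : IsBasic u v y) (hg : Generic u v) {X Y Z : Fin 3}
    (hL : RowLabelling X Y Z) {κ : Fin n} (hκ : π κ = Y) (hYX : flow π y Y X = 0)
    (hYZ : flow π y Y Z = 0) (hlt : -excess u v π Y < v κ) (hpos : 0 < y Z κ)
    (hXZ : flow π y X Z ≠ 0) (hZX : flow π y Z X ≠ 0) :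
    Improvable u v y (fun R j => π j = R) (fun R j => π j = R ∨ (R = Z ∧ j = κ)) := by
  have b := hy.balance (π := π) hL.swap
  have lf := hy.le_flow' (π := π)
  have cc := hy.col_eq hL κ
  have zYX := hy.flow_eq_zero_iff.1 hYX
  have zYZ := hy.flow_eq_zero_iff.1 hYZ
  have hxz := hL.xz
  have fY : ∀ j, 0 < y Y j → π j = Y := by
    intro j hj
    rcases hL.eq_or (π j) with h | h | h
    exacts [absurd (zYX j h) hj.ne', h, absurd (zYZ j h) hj.ne']
  obtain ⟨k, hk, hXk⟩ := hy.exists_of_flow_ne hXZ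
  obtain ⟨l, hl, hZl⟩ := hy.exists_of_flow_ne hZX
  rcases hy.classify hg hL with ⟨p, h⟩ | ⟨p, q, h⟩ | ⟨p, q, h⟩ | ⟨p, q, h⟩
  · have lu := h.unique
    have fl := h.full
    obtain rfl : κ = p := by
      by_contra hcp
      grind
    exact hy.improve_two hg X Z l κ (by grind)
  · have lu := h.unique
    obtain ⟨-, hpq, xp, yp, zp, xq, yq, zq, -⟩ := h
    obtain rfl : κ = q := by
      by_contra hcp
      grind
    exact hy.improve_three hg X Z Y l κ p (by grind [RowLabelling])
  · have lu := h.unique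
    obtain ⟨-, hpq, xp, yp, zp, xq, yq, zq, -⟩ := h
    grind
  · have lu := h.unique
    obtain ⟨-, hpq, xp, yp, zp, xq, yq, zq, -⟩ := h
    obtain rfl : κ = q := by
      by_contra hcp
      grind
    rcases hL.eq_or (π p) with hp | hp | hp
    · exact hy.improve_two hg Z X k p (by grind)
    · have := hy.add_le_flow Z hpq hp hκ
      exact hy.improve_two hg Y Z p κ (by grind)
    · exact hy.improve_two hg X Z l p (by grind)

/-- If row `Y` is a source and the target cell `(Y, κ)` is not in the support, it can enter
without loss. -/
theorem IsBasic.enter_of_source (hy : IsBasic u v y) (hg : Generic u v) {X Y Z : Fin 3}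
    {p q κ : Fin n} (h : IsPath y X Y Z p q) (hp : π p = X) (hq : π q = Z) (hκ : π κ = X)
    (hXY : flow π y X Y = 0) (hZY : flow π y Z Y = 0) (hlt : excess u v π Y < v κ)
    (h0 : y Y κ = 0) :
    Improvable u v y (fun R j => R = Y ∧ j = κ) (fun R j => π j = R) := by
  have b := hy.balance (π := π) h.lab.swap
  have lf := hy.le_flow' (π := π)
  have cc := hy.col_eq h.lab κ
  have lu := h.unique
  obtain ⟨⟨hxy, hxz, hyz⟩, hpq, xp, yp, zp, xq, yq, zq, -⟩ := h
  rcases hy.pos_or_zero X κ with hX | hX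
  · exact hy.improve_two hg Y X κ p (by grind)
  · exact hy.improve_two hg Y Z κ q (by grind)

/-- If row `Y` is a source, the target cell `(Y, κ)` is in the support, and the arcs `X → Z` and
`Z → X` form a cycle, then a cell prescribed by `π` can enter while `(Y, κ)` and all cells
prescribed by `π` stay. -/
theorem IsBasic.improve_of_source (hy : IsBasic u v y) (hg : Generic u v) {X Y Z : Fin 3}
    (hL : RowLabelling X Y Z) {κ : Fin n} (hκ : π κ = X) (hXY : flow π y X Y = 0)
    (hZY : flow π y Z Y = 0) (hlt : excess u v π Y < v κ) (hpos : 0 < y Y κ)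
    (hXZ : flow π y X Z ≠ 0) (hZX : flow π y Z X ≠ 0) :
    Improvable u v y (fun R j => π j = R) (fun R j => π j = R ∨ (R = Y ∧ j = κ)) := by
  have b := hy.balance (π := π) hL.swap
  have lf := hy.le_flow' (π := π)
  have cc := hy.col_eq hL κ
  have n2 := hy.flow_nonneg (π := π) Y Z
  have zXY := hy.flow_eq_zero_iff.1 hXY
  have zZY := hy.flow_eq_zero_iff.1 hZY
  have hxz := hL.xz
  obtain ⟨k, hk, hXk⟩ := hy.exists_of_flow_ne hXZ
  obtain ⟨l, hl, hZl⟩ := hy.exists_of_flow_ne hZX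
  have hleaf : 0 < y X κ ∨ 0 < y Z κ := by
    by_contra! h
    linarith [hy.le_flow Y hκ]
  rcases hy.classify hg hL with ⟨p, h⟩ | ⟨p, q, h⟩ | ⟨p, q, h⟩ | ⟨p, q, h⟩
  · have lu := h.unique
    have fl := h.full
    obtain rfl : κ = p := by
      by_contra hcp
      grind
    exact hy.improve_two hg Z X k κ (by grind)
  · have lu := h.unique
    obtain ⟨-, hpq, xp, yp, zp, xq, yq, zq, -⟩ := h
    obtain rfl | rfl : κ = p ∨ κ = q := by
      by_contra! hcp
      grind
    · rcases hL.eq_or (π q) with hq | hq | hq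
      · have := hy.add_le_flow Y hpq hκ hq
        exact hy.improve_two hg X Y q κ (by grind)
      · exact absurd (zZY q hq) zq.ne'
      · exact hy.improve_three hg X Z Y l q κ (by grind [RowLabelling])
    · rcases hL.eq_or (π p) with hp | hp | hp
      · exact hy.improve_three hg Z X Y k p κ (by grind [RowLabelling])
      · exact absurd (zXY p hp) xp.ne'
      · exact hy.improve_two hg Z Y p κ (by grind)
  · have lu := h.unique
    obtain ⟨-, hpq, xp, yp, zp, xq, yq, zq, -⟩ := h
    obtain rfl : κ = p := by
      by_contra hcp
      grind
    rcases hL.eq_or (π q) with hq | hq | hq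
    · exact hy.improve_two hg Z X k q (by grind)
    · exact absurd (zXY q hq) yq.ne'
    · exact hy.improve_two hg X Z l q (by grind)
  · have lu := h.unique
    obtain ⟨-, hpq, xp, yp, zp, xq, yq, zq, -⟩ := h
    obtain rfl : κ = q := by
      by_contra hcp
      grind
    rcases hL.eq_or (π p) with hp | hp | hp
    · exact hy.improve_two hg Z X k p (by grind)
    · exact absurd (zXY p hp) xp.ne'
    · exact hy.improve_two hg X Z κ p (by grind)

end

/-! ### Targets -/

/-- A basic solution `f` regarded as the target of a walk: every column `j` is served by row
`π j`, and the support of `f` has two further cells `(B, c)` and `(C, d)`. The last three fields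
collect what the walk needs to know about the amounts in these cells. -/
structure Target (u : Fin 3 → ℝ) (v : Fin n → ℝ) (f : Matrix (Fin 3) (Fin n) ℝ)
    (π : Fin n → Fin 3) (B C : Fin 3) (c d : Fin n) : Prop where
  basic : IsBasic u v f
  mem : ∀ R j, 0 < f R j ↔ InTarget π B C c d R j
  hB : π c ≠ B
  hC : π d ≠ C
  ne : B ≠ C
  improve : ∀ {y}, IsBasic u v y → Acyclic π y → (∃ R j, InTarget π B C c d R j ∧ y R j = 0) →
    ∃ e r y', InTarget π B C c d e.1 e.2 ∧ ¬ InTarget π B C c d r.1 r.2 ∧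
      IsPivot u v y e r y' ∧ Acyclic π y'
  source : ∀ {y X Y Z}, IsBasic u v y → RowLabelling X Y Z → flow π y X Y = 0 →
    flow π y Z Y = 0 →
    ∃ κ, ((Y = B ∧ κ = c) ∨ (Y = C ∧ κ = d)) ∧ excess u v π Y < v κ
  sink : ∀ {y X Y Z}, IsBasic u v y → RowLabelling X Y Z → flow π y Y X = 0 →
    flow π y Y Z = 0 →
    ∃ W κ, ((W = B ∧ κ = c) ∨ (W = C ∧ κ = d)) ∧ π κ = Y ∧ -excess u v π Y < v κ

section

variable {u : Fin 3 → ℝ} {v : Fin n → ℝ} {y y' f : Matrix (Fin 3) (Fin n) ℝ} {π : Fin n → Fin 3}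
  {A B C : Fin 3} {c d : Fin n} {α β : ℝ}

/-- A pivot preserves an order of the rows compatible with the flow if the entering cell respects
it. -/
theorem IsPivot.acyclic {e r : Fin 3 × Fin n} (h : IsPivot u v y e r y') (hy : IsBasic u v y)
    {X Y Z : Fin 3} (hL : RowLabelling X Y Z) (h1 : flow π y Z Y = 0) (h2 : flow π y Z X = 0)
    (h3 : flow π y Y X = 0)
    (he : π e.2 = e.1 ∨ ¬ ((e.1 = Z ∧ (π e.2 = Y ∨ π e.2 = X)) ∨ (e.1 = Y ∧ π e.2 = X))) :
    Acyclic π y' := by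
  have hxy := hL.xy
  have hxz := hL.xz
  have hyz := hL.yz
  refine ⟨X, Y, Z, hL, h.flow_eq_zero hy ?_ h1, h.flow_eq_zero hy ?_ h2,
    h.flow_eq_zero hy ?_ h3⟩ <;> grind

/-- As `A` receives and `C` sends a positive net amount, only three orders of the rows are
compatible with an acyclic flow. -/
theorem PathTarget.improve (ht : PathTarget u v π A B C c d α β) (hg : Generic u v)
    (hy : IsBasic u v y) (hac : Acyclic π y)
    (hm : ∃ R j, InTarget π B C c d R j ∧ y R j = 0) :
    ∃ e r y', InTarget π B C c d e.1 e.2 ∧ ¬ InTarget π B C c d r.1 r.2 ∧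
      IsPivot u v y e r y' ∧ Acyclic π y' := by
  have hL := ht.lab
  have hc := ht.hc
  have bA := hy.balance (π := π) hL
  have bC := hy.balance (π := π) hL.rev
  rw [ht.exA] at bA
  rw [ht.exC] at bC
  have hα := ht.α_pos
  have hβ := ht.β_pos
  have nn := fun R S => hy.flow_nonneg (π := π) R S
  have n1 := nn A B
  have n2 := nn A C
  have n3 := nn B C
  have CBA : flow π y A B = 0 → flow π y A C = 0 → flow π y B C = 0 →
      ∃ e r y', InTarget π B C c d e.1 e.2 ∧ ¬ InTarget π B C c d r.1 r.2 ∧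
        IsPivot u v y e r y' ∧ Acyclic π y' := by
    intro h1 h2 h3
    obtain ⟨e, r, he, hr, y', hp⟩ := ht.improve_CBA hg hy h1 h2 h3 hm
    exact ⟨e, r, y', he, hr, hp, hp.acyclic hy hL.rev h1 h2 h3 (by grind [InTarget])⟩
  obtain ⟨X, Y, Z, hXYZ, h1, h2, h3⟩ := hac
  have gxy := hXYZ.xy
  have gxz := hXYZ.xz
  have gyz := hXYZ.yz
  rcases hL.eq_or Z with rfl | rfl | rfl <;> rcases hL.eq_or Y with rfl | rfl | rfl <;>
    rcases hL.eq_or X with rfl | rfl | rfl <;> first | contradiction | skip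
  · exact CBA h1 h2 h3
  · by_cases h0 : flow π y X Y = 0
    · exact CBA h2 h1 h0
    · obtain ⟨e, r, he, hr, y', hp⟩ := ht.improve_BCA hg hy h2 h1 h3 h0
      exact ⟨e, r, y', by grind [InTarget], hr, hp, hp.acyclic hy hXYZ h1 h2 h3 (by grind)⟩
  · by_cases h0 : flow π y Y Z = 0
    · exact CBA h0 h3 h2
    · obtain ⟨e, r, he, hr, y', hp⟩ := ht.improve_CAB hg hy h3 h1 h2 h0
      exact ⟨e, r, y', by grind [InTarget], hr, hp, hp.acyclic hy hXYZ h1 h2 h3 (by grind)⟩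
  · linarith
  · linarith
  · linarith

/-- As `A` receives a positive net amount and `B` and `C` send one, only two orders of the rows are
compatible with an acyclic flow, and they are exchanged by swapping `B` and `C`. -/
theorem StarTarget.improve (ht : StarTarget u v π A B C c α β) (hg : Generic u v)
    (hy : IsBasic u v y) (hac : Acyclic π y)
    (hm : ∃ R j, InTarget π B C c c R j ∧ y R j = 0) :
    ∃ e r y', InTarget π B C c c e.1 e.2 ∧ ¬ InTarget π B C c c r.1 r.2 ∧
      IsPivot u v y e r y' ∧ Acyclic π y' := by
  have key : ∀ {A B C : Fin 3} {α β : ℝ}, StarTarget u v π A B C c α β →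
      (∃ R j, InTarget π B C c c R j ∧ y R j = 0) →
      flow π y A B = 0 → flow π y A C = 0 → flow π y B C = 0 →
      ∃ e r y', InTarget π B C c c e.1 e.2 ∧ ¬ InTarget π B C c c r.1 r.2 ∧
        IsPivot u v y e r y' ∧ Acyclic π y' := by
    intro A B C α β ht hm h1 h2 h3
    obtain ⟨e, r, he, hr, y', hp⟩ := ht.improve_CBA hg hy h1 h2 h3 hm
    have hc := ht.hc
    obtain ⟨hxy, hxz, hyz⟩ := ht.lab
    exact ⟨e, r, y', he, hr, hp, hp.acyclic hy ht.lab.rev h1 h2 h3 (by grind [InTarget])⟩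
  have comm : ∀ R j, InTarget π C B c c R j ↔ InTarget π B C c c R j := by
    intro R j
    unfold InTarget
    tauto
  have hL := ht.lab
  have bA := hy.balance (π := π) hL
  have bB := hy.balance (π := π) hL.swap
  have bC := hy.balance (π := π) hL.rev
  rw [ht.exA] at bA
  rw [ht.exB] at bB
  rw [ht.exC] at bC
  have hα := ht.α_pos
  have hβ := ht.β_pos
  have nn := fun R S => hy.flow_nonneg (π := π) R S
  have n1 := nn A B
  have n2 := nn A C
  have n3 := nn B C
  have n4 := nn C B
  obtain ⟨X, Y, Z, hXYZ, h1, h2, h3⟩ := hac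
  have gxy := hXYZ.xy
  have gxz := hXYZ.xz
  have gyz := hXYZ.yz
  rcases hL.eq_or Z with rfl | rfl | rfl <;> rcases hL.eq_or Y with rfl | rfl | rfl <;>
    rcases hL.eq_or X with rfl | rfl | rfl <;> first | contradiction | skip
  · exact key ht hm h1 h2 h3
  · have := key ht.swap (by simpa only [comm] using hm) h1 h2 h3
    simpa only [comm] using this
  · linarith
  · linarith
  · linarith
  · linarith

theorem PathTarget.target (ht : PathTarget u v π A B C c d α β) (hg : Generic u v)
    (hf : IsBasic u v f) (hmem : ∀ R j, 0 < f R j ↔ InTarget π B C c d R j) :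
    Target u v f π B C c d := by
  have hL := ht.lab
  refine ⟨hf, hmem, ht.hc ▸ hL.xy, ht.hd ▸ hL.yz, hL.yz, ht.improve hg, ?_, ?_⟩
  all_goals
    intro y X Y Z hy hXYZ h1 h2
    have b := hy.balance (π := π) hXYZ.swap
    have n1 := hy.flow_nonneg (π := π) X Y
    have n2 := hy.flow_nonneg (π := π) Z Y
    have n3 := hy.flow_nonneg (π := π) Y X
    have n4 := hy.flow_nonneg (π := π) Y Z
    obtain ⟨-, hc, hd, hα, hβ, hαc, hβd, exA, exB, exC⟩ := ht
    rcases hL.eq_or Y with rfl | rfl | rfl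
  · linarith
  · exact ⟨c, Or.inl ⟨rfl, rfl⟩, by linarith⟩
  · exact ⟨d, Or.inr ⟨rfl, rfl⟩, by linarith⟩
  · exact ⟨B, c, Or.inl ⟨rfl, rfl⟩, hc, by linarith⟩
  · exact ⟨C, d, Or.inr ⟨rfl, rfl⟩, hd, by linarith⟩
  · linarith

theorem StarTarget.target (ht : StarTarget u v π A B C c α β) (hg : Generic u v)
    (hf : IsBasic u v f) (hmem : ∀ R j, 0 < f R j ↔ InTarget π B C c c R j) :
    Target u v f π B C c c := by
  have hL := ht.lab
  refine ⟨hf, hmem, ht.hc ▸ hL.xy, ht.hc ▸ hL.xz, hL.yz, ht.improve hg, ?_, ?_⟩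
  all_goals
    intro y X Y Z hy hXYZ h1 h2
    have b := hy.balance (π := π) hXYZ.swap
    have n1 := hy.flow_nonneg (π := π) X Y
    have n2 := hy.flow_nonneg (π := π) Z Y
    have n3 := hy.flow_nonneg (π := π) Y X
    have n4 := hy.flow_nonneg (π := π) Y Z
    obtain ⟨-, hc, hα, hβ, hαc, exA, exB, exC⟩ := ht
    rcases hL.eq_or Y with rfl | rfl | rfl
  · linarith
  · exact ⟨c, Or.inl ⟨rfl, rfl⟩, by linarith⟩
  · exact ⟨c, Or.inr ⟨rfl, rfl⟩, by linarith⟩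
  · exact ⟨B, c, Or.inl ⟨rfl, rfl⟩, hc, by linarith⟩
  · linarith
  · linarith

theorem IsPath.target {X Y Z : Fin 3} {p q : Fin n} (h : IsPath f X Y Z p q) (hg : Generic u v)
    (hf : IsBasic u v f) : ∃ π, Target u v f π Y Z p q := by
  obtain ⟨hL, hpq, xp, yp, zp, xq, yq, zq, hl⟩ := h
  have : ∀ j, ∃ R, (j = p → R = X) ∧ (j = q → R = Y) ∧ (j ≠ p → j ≠ q → IsLeaf f j R) := by
    intro j
    by_cases hp : j = p
    · exact ⟨X, by grind⟩
    · by_cases hq : j = q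
      · exact ⟨Y, by grind⟩
      · obtain ⟨R, hR⟩ := hl j hp hq
        exact ⟨R, by grind⟩
  choose π hπp hπq hπ using this
  have hp := hπp p rfl
  have hq := hπq q rfl
  have hxy := hL.xy
  have hxz := hL.xz
  have hyz := hL.yz
  have mem : ∀ R j, 0 < f R j ↔ InTarget π Y Z p q R j := by
    intro R j
    rcases eq_or_ne j p with rfl | hjp
    · rcases hL.eq_or R with rfl | rfl | rfl <;> grind [InTarget]
    · rcases eq_or_ne j q with rfl | hjq
      · rcases hL.eq_or R with rfl | rfl | rfl <;> grind [InTarget]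
      · obtain ⟨h1, h2⟩ := hπ j hjp hjq
        grind [InTarget]
  have zero : ∀ R S, R ≠ S → ¬ (R = Y ∧ S = X) → ¬ (R = Z ∧ S = Y) → flow π f R S = 0 := by
    intro R S hRS h1 h2
    refine hf.flow_eq_zero_iff.2 fun j hj => (hf.pos_or_zero _ _).resolve_left fun hpos => ?_
    grind [InTarget]
  have hYX : flow π f Y X = f Y p := flow_eq_single hp fun j hjp hj =>
    (hf.pos_or_zero _ _).resolve_left fun hpos => by
      grind [InTarget]
  have hZY : flow π f Z Y = f Z q := flow_eq_single hq fun j hjq hj =>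
    (hf.pos_or_zero _ _).resolve_left fun hpos => by
      grind [InTarget]
  have bX := hf.balance (π := π) hL
  have bY := hf.balance (π := π) hL.swap
  have bZ := hf.balance (π := π) hL.rev
  have z1 := zero X Y hxy (by grind) (by grind)
  have z2 := zero X Z hxz (by grind) (by grind)
  have z3 := zero Y Z hyz (by grind) (by grind)
  have z4 := zero Z X hxz.symm (by grind) (by grind)
  have cp := hf.col_eq hL p
  have cq := hf.col_eq hL q
  exact ⟨π, (PathTarget.mk (α := f Y p) (β := f Z q) hL hp hq yp zq (by linarith) (by linarith)
    (by linarith) (by linarith) (by linarith)).target hg hf mem⟩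

theorem IsStar.target {p : Fin n} (h : IsStar f p) (hg : Generic u v)
    (hf : IsBasic u v f) : ∃ π, Target u v f π 1 2 p p := by
  have hL : RowLabelling 0 1 2 := by constructor <;> decide
  obtain ⟨fl, hl⟩ := h
  have : ∀ j, ∃ R, (j = p → R = 0) ∧ (j ≠ p → IsLeaf f j R) := by
    intro j
    by_cases hp : j = p
    · exact ⟨0, by grind⟩
    · obtain ⟨R, hR⟩ := hl j hp
      exact ⟨R, by grind⟩
  choose π hπp hπ using this
  have hp := hπp p rfl
  have mem : ∀ R j, 0 < f R j ↔ InTarget π 1 2 p p R j := by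
    intro R j
    rcases eq_or_ne j p with rfl | hjp
    · have := fl R
      grind [InTarget]
    · obtain ⟨h1, h2⟩ := hπ j hjp
      grind [InTarget]
  have zero : ∀ R S, R ≠ S → ¬ (R = 1 ∧ S = 0) → ¬ (R = 2 ∧ S = 0) → flow π f R S = 0 := by
    intro R S hRS h1 h2
    refine hf.flow_eq_zero_iff.2 fun j hj => (hf.pos_or_zero _ _).resolve_left fun hpos => ?_
    grind [InTarget]
  have h10 : flow π f 1 0 = f 1 p := flow_eq_single hp fun j hjp hj =>
    (hf.pos_or_zero _ _).resolve_left fun hpos => by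
      grind [InTarget]
  have h20 : flow π f 2 0 = f 2 p := flow_eq_single hp fun j hjq hj =>
    (hf.pos_or_zero _ _).resolve_left fun hpos => by
      grind [InTarget]
  have b0 := hf.balance (π := π) hL
  have b1 := hf.balance (π := π) hL.swap
  have b2 := hf.balance (π := π) hL.rev
  have z1 := zero 0 1 (by decide) (by decide) (by decide)
  have z2 := zero 0 2 (by decide) (by decide) (by decide)
  have z3 := zero 1 2 (by decide) (by decide) (by decide)
  have z4 := zero 2 1 (by decide) (by decide) (by decide)
  have cp := hf.col_eq hL p
  have := fl 0
  exact ⟨π, (StarTarget.mk (α := f 1 p) (β := f 2 p) hL hp (fl 1) (fl 2) (by linarith)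
    (by linarith) (by linarith) (by linarith)).target hg hf mem⟩

theorem IsBasic.exists_target (hg : Generic u v) (hf : IsBasic u v f) :
    ∃ π B C c d, Target u v f π B C c d := by
  have hL : RowLabelling 0 1 2 := by constructor <;> decide
  rcases hf.classify hg hL with ⟨p, h⟩ | ⟨p, q, h⟩ | ⟨p, q, h⟩ | ⟨p, q, h⟩ <;>
  · obtain ⟨π, hπ⟩ := h.target hg hf
    exact ⟨π, _, _, _, _, hπ⟩

end

/-! ### The length of a walk for generic margins -/

/-- `PivotWalk u v f k y`: the basic solution `f` is reached from `y` by `k` pivots. -/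
inductive PivotWalk (u : Fin 3 → ℝ) (v : Fin n → ℝ) (f : Matrix (Fin 3) (Fin n) ℝ) :
    ℕ → Matrix (Fin 3) (Fin n) ℝ → Prop
  | refl : PivotWalk u v f 0 f
  | step {k y e r y'} : IsPivot u v y e r y' → PivotWalk u v f k y' → PivotWalk u v f (k + 1) y

/-- `f` is reached from `y` by at most `k` pivots. -/
def Within (u : Fin 3 → ℝ) (v : Fin n → ℝ) (f : Matrix (Fin 3) (Fin n) ℝ) (k : ℕ)
    (y : Matrix (Fin 3) (Fin n) ℝ) : Prop :=
  ∃ m ≤ k, PivotWalk u v f m y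

/-- The cells prescribed by `π`. -/
def served (π : Fin n → Fin 3) : Finset (Fin 3 × Fin n) := univ.image fun j => (π j, j)

theorem mem_served {π : Fin n → Fin 3} {e : Fin 3 × Fin n} : e ∈ served π ↔ π e.2 = e.1 := by
  simp only [served, mem_image, mem_univ, true_and]
  constructor
  · rintro ⟨j, rfl⟩
    rfl
  · exact fun h => ⟨e.2, Prod.ext h rfl⟩

section

variable {u : Fin 3 → ℝ} {v : Fin n → ℝ} {y y' f : Matrix (Fin 3) (Fin n) ℝ} {π : Fin n → Fin 3}
  {B C : Fin 3} {c d : Fin n} {e r : Fin 3 × Fin n} {k l : ℕ}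

theorem Within.mono (h : Within u v f k y) (hkl : k ≤ l) : Within u v f l y :=
  let ⟨m, hm, hw⟩ := h
  ⟨m, hm.trans hkl, hw⟩

theorem Within.step (h : Within u v f k y') (hp : IsPivot u v y e r y') :
    Within u v f (k + 1) y :=
  let ⟨m, hm, hw⟩ := h
  ⟨m + 1, Nat.succ_le_succ hm, hw.step hp⟩

/-- Missing cells of `F` are counted by `F \ supp y`; a pivot bringing in one of them and removing
no cell of `F` decreases their number. -/
theorem IsPivot.card_sdiff (h : IsPivot u v y e r y') {F : Finset (Fin 3 × Fin n)} (he : e ∈ F)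
    (hr : r ∉ F) : (F \ supp y').card + 1 = (F \ supp y).card := by
  have : F \ supp y' = (F \ supp y).erase e := by
    ext a
    rw [h.supp_eq]
    simp only [mem_sdiff, mem_insert, mem_erase]
    constructor
    · rintro ⟨h1, h2⟩
      push Not at h2
      refine ⟨h2.1, h1, fun h3 => h2.2 ?_ h3⟩
      rintro rfl
      exact hr h1
    · rintro ⟨h1, h2, h3⟩
      exact ⟨h2, fun h4 => h4.elim h1 fun h5 => h3 h5.2⟩
  rw [this, card_erase_add_one (mem_sdiff.2 ⟨he, h.enter⟩)]

theorem IsPivot.sdiff_eq (h : IsPivot u v y e r y') {F : Finset (Fin 3 × Fin n)} (he : e ∉ F)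
    (hr : r ∉ F) : F \ supp y' = F \ supp y := by
  ext a
  rw [h.supp_eq]
  simp only [mem_sdiff, mem_insert, mem_erase]
  constructor
  · rintro ⟨h1, h2⟩
    push Not at h2
    refine ⟨h1, fun h3 => h2.2 ?_ h3⟩
    rintro rfl
    exact hr h1
  · rintro ⟨h1, h2⟩
    refine ⟨h1, fun h3 => h3.elim ?_ fun h4 => h2 h4.2⟩
    rintro rfl
    exact he h1

/-- A basic solution is determined by its support. -/
theorem IsBasic.eq_of_supp_subset (hy : IsBasic u v y) (hf : IsBasic u v f)
    (h : supp f ⊆ supp y) : y = f := by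
  have hz : ZeroMargin (Matrix.of fun i j => f i j - y i j) :=
    ⟨fun i => by simp [sum_sub_distrib, hf.row, hy.row],
      fun j => by simp [sum_sub_distrib, hf.col, hy.col]⟩
  have := hy.ker _ hz fun i j hij => by
    have hfij : f i j = 0 := (hf.pos_or_zero i j).resolve_left fun hpos => by
      have : (i, j) ∈ supp y := h (by simpa using hpos)
      simp [hij] at this
    simp [hij, hfij]
  ext i j
  have := this i j
  simp only [Matrix.of_apply] at this
  linarith

namespace Target

theorem mem_supp_iff (ht : Target u v f π B C c d) {e : Fin 3 × Fin n} :
    e ∈ supp f ↔ e ∈ served π ∨ e = (B, c) ∨ e = (C, d) := by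
  rw [mem_supp, ht.mem, mem_served, InTarget, Prod.ext_iff, Prod.ext_iff]

/-- From an acyclic flow pattern the target is reached by bringing in its missing cells one by
one. -/
theorem within_of_acyclic (ht : Target u v f π B C c d) (hy : IsBasic u v y)
    (hac : Acyclic π y) : Within u v f (supp f \ supp y).card y := by
  induction hk : (supp f \ supp y).card generalizing y with
  | zero =>
    rw [card_eq_zero, sdiff_eq_empty_iff_subset] at hk
    rw [hy.eq_of_supp_subset ht.basic hk]
    exact ⟨0, le_rfl, .refl⟩
  | succ k ih =>
    have hm : ∃ R j, InTarget π B C c d R j ∧ y R j = 0 := by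
      obtain ⟨e, he⟩ : (supp f \ supp y).Nonempty := card_pos.1 (by omega)
      rw [mem_sdiff, mem_supp, mem_supp, ht.mem] at he
      exact ⟨e.1, e.2, he.1, (hy.pos_or_zero _ _).resolve_left he.2⟩
    obtain ⟨e, r, y', he, hr, hp, hac'⟩ := ht.improve hy hac hm
    rw [← ht.mem, ← mem_supp] at he hr
    have := hp.card_sdiff he hr
    exact (ih hp.basic hac' (by omega)).step hp

/-- The walk brings in cells prescribed by `π`, in states satisfying `S`, until the flow pattern
is acyclic; of the two further target cells only those in `N` can be missing then. -/
theorem within_of_descent (ht : Target u v f π B C c d) (N : Finset (Fin 3 × Fin n))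
    (S : Matrix (Fin 3) (Fin n) ℝ → Prop)
    (hN : ∀ y, IsBasic u v y → S y → ∀ e, e = (B, c) ∨ e = (C, d) → e ∉ supp y → e ∈ N)
    (hS : ∀ y, IsBasic u v y → S y → ¬ Acyclic π y → ∃ e r y', π e.2 = e.1 ∧ π r.2 ≠ r.1 ∧
      IsPivot u v y e r y' ∧ S y')
    (hy : IsBasic u v y) (hSy : S y) : Within u v f ((served π \ supp y).card + N.card) y := by
  induction hk : (served π \ supp y).card generalizing y with
  | zero | succ k ih =>
    by_cases hac : Acyclic π y
    · refine (ht.within_of_acyclic hy hac).mono ?_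
      rw [← hk]
      refine (card_le_card fun e he => ?_).trans (card_union_le _ _)
      rw [mem_sdiff, ht.mem_supp_iff] at he
      rw [mem_union, mem_sdiff]
      exact he.1.imp (fun h => ⟨h, he.2⟩) fun h => hN y hy hSy e h he.2
    · obtain ⟨e, r, y', he, hr, hp, hS'⟩ := hS y hy hSy hac
      have := hp.card_sdiff (mem_served.2 he) (mt mem_served.1 hr)
      first
        | omega
        | exact ((ih hp.basic hS' (by omega)).step hp).mono (by omega)

/-- The case that a row `Y` is a sink of the flow. -/
theorem within_of_sink (ht : Target u v f π B C c d) (hg : Generic u v)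
    {K : Finset (Fin 3 × Fin n)} (hK : ∀ y, IsBasic u v y → K ⊆ supp y) (hy : IsBasic u v y)
    {X Y Z : Fin 3} {p q : Fin n} (h : IsPath y X Y Z p q) (hYX : flow π y Y X = 0)
    (hYZ : flow π y Y Z = 0) :
    Within u v f ((served π \ supp y).card + (({(B, c), (C, d)} : Finset _) \ K).card) y := by
  obtain ⟨W, κ, hW, hκ, hlt⟩ := ht.sink hy h.lab hYX hYZ
  -- reversing the path exchanges `X` and `Z`
  wlog hWZ : W = Z generalizing X Z p q
  · refine this h.rev hYZ hYX ?_
    rcases h.lab.eq_or W with hW' | hW' | hW'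
    · exact hW'
    · have := ht.hB
      have := ht.hC
      grind
    · exact absurd hW' hWZ
  subst hWZ
  have hL := h.lab
  set N := ({(B, c), (C, d)} : Finset (Fin 3 × Fin n)) \ K with hNdef
  have key : ∀ {y}, IsBasic u v y → flow π y Y X = 0 → flow π y Y W = 0 → 0 < y W κ →
      Within u v f ((served π \ supp y).card + (N.erase (W, κ)).card) y := by
    intro y hy h1 h2 h3
    refine ht.within_of_descent (N.erase (W, κ))
      (fun y => flow π y Y X = 0 ∧ flow π y Y W = 0 ∧ 0 < y W κ) ?_ ?_ hy ⟨h1, h2, h3⟩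
    · rintro y hy ⟨h1, h2, h3⟩ e he hey
      rw [mem_erase, hNdef, mem_sdiff, mem_insert, mem_singleton]
      refine ⟨?_, he, fun heK => hey (hK y hy heK)⟩
      rintro rfl
      exact hey (by simpa using h3)
    · rintro y hy ⟨h1, h2, h3⟩ hac
      have hXW : flow π y X W ≠ 0 := fun h0 => hac ⟨W, X, Y, hL.rev.swap', h1, h2, h0⟩
      have hWX : flow π y W X ≠ 0 := fun h0 => hac ⟨X, W, Y, hL.swap', h2, h1, h0⟩
      obtain ⟨e, r, he, hr, y', hp⟩ := hy.improve_of_sink hg hL hκ h1 h2 hlt h3 hXW hWX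
      push Not at hr
      refine ⟨e, r, y', he, hr.1, hp, hp.flow_eq_zero hy ?_ h1, hp.flow_eq_zero hy ?_ h2,
        hp.pos_of_ne h3 ?_⟩
      · grind [hL.xy]
      · grind [hL.yz]
      · rintro rfl
        exact hr.2 rfl rfl
  rcases hy.pos_or_zero W κ with h0 | h0
  · exact (key hy hYX hYZ h0).mono (by gcongr; exact erase_subset _ _)
  · obtain ⟨e, r, he, hr, y', hp⟩ := hy.enter_of_sink hg h hκ hYX hYZ hlt h0
    obtain rfl : e = (W, κ) := Prod.ext he.1 he.2
    have hmem : (W, κ) ∈ N := by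
      rw [hNdef, mem_sdiff, mem_insert, mem_singleton, Prod.mk.injEq, Prod.mk.injEq]
      exact ⟨hW, fun hKe => hp.enter (hK y hy hKe)⟩
    have hYW := hL.yz
    have := key hp.basic (hp.flow_eq_zero hy (Or.inl hYW.symm) hYX)
      (hp.flow_eq_zero hy (Or.inl hYW.symm) hYZ) hp.pos_enter
    rw [hp.sdiff_eq (F := served π) (by simpa [mem_served, hκ] using hYW)
      (mt mem_served.1 hr)] at this
    refine (this.step hp).mono ?_
    rw [add_assoc, card_erase_add_one hmem]

/-- The case that a row `Y` is a source of the flow. -/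
theorem within_of_source (ht : Target u v f π B C c d) (hg : Generic u v)
    {K : Finset (Fin 3 × Fin n)} (hK : ∀ y, IsBasic u v y → K ⊆ supp y) (hy : IsBasic u v y)
    {X Y Z : Fin 3} {p q : Fin n} (h : IsPath y X Y Z p q) (hp : π p = X) (hq : π q = Z)
    (hXY : flow π y X Y = 0) (hZY : flow π y Z Y = 0) :
    Within u v f ((served π \ supp y).card + (({(B, c), (C, d)} : Finset _) \ K).card) y := by
  obtain ⟨κ, hW, hlt⟩ := ht.source hy h.lab hXY hZY
  have hκY : π κ ≠ Y := by
    have := ht.hB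
    have := ht.hC
    grind
  -- reversing the path exchanges `X` and `Z`
  wlog hκ : π κ = X generalizing X Z p q
  · refine this h.rev hq hp hZY hXY ?_
    rcases h.lab.eq_or (π κ) with h' | h' | h'
    exacts [absurd h' hκ, absurd h' hκY, h']
  have hL := h.lab
  set N := ({(B, c), (C, d)} : Finset (Fin 3 × Fin n)) \ K with hNdef
  have key : ∀ {y}, IsBasic u v y → flow π y X Y = 0 → flow π y Z Y = 0 → 0 < y Y κ →
      Within u v f ((served π \ supp y).card + (N.erase (Y, κ)).card) y := by
    intro y hy h1 h2 h3
    refine ht.within_of_descent (N.erase (Y, κ))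
      (fun y => flow π y X Y = 0 ∧ flow π y Z Y = 0 ∧ 0 < y Y κ) ?_ ?_ hy ⟨h1, h2, h3⟩
    · rintro y hy ⟨h1, h2, h3⟩ e he hey
      rw [mem_erase, hNdef, mem_sdiff, mem_insert, mem_singleton]
      refine ⟨?_, he, fun heK => hey (hK y hy heK)⟩
      rintro rfl
      exact hey (by simpa using h3)
    · rintro y hy ⟨h1, h2, h3⟩ hac
      have hXZ : flow π y X Z ≠ 0 := fun h0 => hac ⟨Y, Z, X, hL.swap.swap', h0, h1, h2⟩
      have hZX : flow π y Z X ≠ 0 := fun h0 => hac ⟨Y, X, Z, hL.swap, h0, h2, h1⟩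
      obtain ⟨e, r, he, hr, y', hp⟩ := hy.improve_of_source hg hL hκ h1 h2 hlt h3 hXZ hZX
      push Not at hr
      refine ⟨e, r, y', he, hr.1, hp, hp.flow_eq_zero hy ?_ h1, hp.flow_eq_zero hy ?_ h2,
        hp.pos_of_ne h3 ?_⟩
      · grind [hL.xy]
      · grind [hL.yz]
      · rintro rfl
        exact hr.2 rfl rfl
  rcases hy.pos_or_zero Y κ with h0 | h0
  · exact (key hy hXY hZY h0).mono (by gcongr; exact erase_subset _ _)
  · obtain ⟨e, r, he, hr, y', hp'⟩ := hy.enter_of_source hg h hp hq hκ hXY hZY hlt h0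
    obtain rfl : e = (Y, κ) := Prod.ext he.1 he.2
    have hmem : (Y, κ) ∈ N := by
      rw [hNdef, mem_sdiff, mem_insert, mem_singleton, Prod.mk.injEq, Prod.mk.injEq]
      exact ⟨hW, fun hKe => hp'.enter (hK y hy hKe)⟩
    have := key hp'.basic (hp'.flow_eq_zero hy (Or.inl hL.xy.symm) hXY)
      (hp'.flow_eq_zero hy (Or.inl hL.yz) hZY) hp'.pos_enter
    rw [hp'.sdiff_eq (F := served π) (by simpa [mem_served] using hκY)
      (mt mem_served.1 hr)] at this
    refine (this.step hp').mono ?_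
    rw [add_assoc, card_erase_add_one hmem]

/-- The target is reached by as many pivots as there are missing cells prescribed by `π`, plus one
for each of the two further target cells that is not in `K`. -/
theorem within (ht : Target u v f π B C c d) (hg : Generic u v)
    {K : Finset (Fin 3 × Fin n)} (hK : ∀ y, IsBasic u v y → K ⊆ supp y) (hy : IsBasic u v y) :
    Within u v f ((served π \ supp y).card + (({(B, c), (C, d)} : Finset _) \ K).card) y := by
  induction hk : (served π \ supp y).card using Nat.strong_induction_on generalizing y with
  | _ k ih =>
    by_cases hst : Improvable u v y (fun R j => π j = R) (fun R j => π j = R)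
    · obtain ⟨e, r, he, hr, y', hp⟩ := hst
      have := hp.card_sdiff (mem_served.2 he) (mt mem_served.1 hr)
      exact ((ih _ (by omega) hp.basic rfl).step hp).mono (by omega)
    · rw [← hk]
      rcases hy.acyclic_or_of_not_improvable hg hst with hac | ⟨X, Y, Z, p, q, h, hpq⟩
      · refine (ht.within_of_acyclic hy hac).mono ?_
        refine (card_le_card fun e he => ?_).trans (card_union_le _ _)
        rw [mem_sdiff, ht.mem_supp_iff] at he
        rw [mem_union, mem_sdiff, mem_sdiff, mem_insert, mem_singleton]
        exact he.1.imp (fun h => ⟨h, he.2⟩) fun h => ⟨h, fun h' => he.2 (hK y hy h')⟩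
      · rcases hpq with ⟨h1, h2, h3, h4⟩ | ⟨h1, h2⟩
        · exact ht.within_of_source hg hK hy h h1 h2 h3 h4
        · exact ht.within_of_sink hg hK hy h h1 h2

end Target

/-- The Hirsch bound for generic margins: if the cells in `K` belong to the support of every basic
solution, any two basic solutions are joined by a walk of at most `n + 2 - |K|` pivots. -/
theorem exists_pivotWalk (hg : Generic u v) {K : Finset (Fin 3 × Fin n)}
    (hK : ∀ y, IsBasic u v y → K ⊆ supp y) (hy : IsBasic u v y) (hf : IsBasic u v f) :
    ∃ k, k + K.card ≤ n + 2 ∧ PivotWalk u v f k y := by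
  obtain ⟨π, B, C, c, d, ht⟩ := hf.exists_target hg
  obtain ⟨k, hk, hw⟩ := ht.within hg hK hy
  refine ⟨k, ?_, hw⟩
  set N := ({(B, c), (C, d)} : Finset (Fin 3 × Fin n)) \ K
  have hdisj : Disjoint (served π \ supp y) N := by
    rw [disjoint_left]
    intro e he heN
    rw [mem_sdiff, mem_served] at he
    rw [mem_sdiff, mem_insert, mem_singleton] at heN
    rcases heN.1 with rfl | rfl
    exacts [ht.hB he.1, ht.hC he.1]
  have hsub : (served π \ supp y) ∪ N ⊆ supp f \ K := by
    intro e he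
    rw [mem_union, mem_sdiff, mem_sdiff, mem_insert, mem_singleton] at he
    rw [mem_sdiff, ht.mem_supp_iff]
    rcases he with he | he
    exacts [⟨Or.inl he.1, fun h => he.2 (hK y hy h)⟩, ⟨Or.inr he.1, he.2⟩]
  have h1 := card_le_card hsub
  rw [card_union_of_disjoint hdisj] at h1
  have h2 := card_sdiff_add_card_eq_card (hK f hf)
  rw [hf.card_supp hg] at h2
  omega

end

/-! ### Vertices and edges of a transportation polytope -/

open Filter Topology

section

variable {u : Fin 3 → ℝ} {v : Fin n → ℝ} {x y : Matrix (Fin 3) (Fin n) ℝ}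

theorem IsBasic.mem_polytope (h : IsBasic u v x) : x ∈ transportationPolytope u v :=
  ⟨h.row, h.col, h.nonneg⟩

theorem zeroMargin_sub {a b : Matrix (Fin 3) (Fin n) ℝ} (ha : a ∈ transportationPolytope u v)
    (hb : b ∈ transportationPolytope u v) : ZeroMargin (Matrix.of fun i j => a i j - b i j) :=
  ⟨fun i => by simp [sum_sub_distrib, ha.1, hb.1],
    fun j => by simp [sum_sub_distrib, ha.2.1, hb.2.1]⟩

theorem eq_zero_of_mem_openSegment {a b z : Matrix (Fin 3) (Fin n) ℝ}
    (ha : a ∈ transportationPolytope u v) (hb : b ∈ transportationPolytope u v)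
    (hz : z ∈ openSegment ℝ a b) {i : Fin 3} {j : Fin n} (h0 : z i j = 0) : a i j = 0 := by
  obtain ⟨s, t, hs, ht, -, rfl⟩ := hz
  have h1 := ha.2.2 i j
  have h2 := hb.2.2 i j
  simp only [Matrix.add_apply, Matrix.smul_apply, smul_eq_mul] at h0
  have h3 := mul_nonneg hs.le h1
  have h4 := mul_nonneg ht.le h2
  have h5 : s * a i j = 0 := by linarith
  exact (mul_eq_zero.1 h5).resolve_left hs.ne'

/-- The vertices of a transportation polytope are its basic feasible solutions. -/
theorem mem_extremePoints_iff_isBasic :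
    x ∈ (transportationPolytope u v).extremePoints ℝ ↔ IsBasic u v x := by
  constructor
  · intro hx
    have hxP := hx.1
    refine ⟨hxP.2.2, hxP.1, hxP.2.1, fun z hz h0 => ?_⟩
    have hev : ∀ᶠ t : ℝ in 𝓝[>] 0, ∀ i j, t * |z i j| ≤ x i j := by
      simp only [eventually_all]
      intro i j
      rcases (hxP.2.2 i j).eq_or_lt with hxij | hxij
      · rw [h0 i j hxij.symm, ← hxij]
        simp
      · have : Tendsto (fun t : ℝ => t * |z i j|) (𝓝[>] 0) (𝓝 (0 * |z i j|)) :=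
          (tendsto_id.mono_left nhdsWithin_le_nhds).mul_const _
        rw [zero_mul] at this
        exact (this.eventually_lt_const hxij).mono fun t => le_of_lt
    obtain ⟨t, ht, ht0⟩ := (hev.and self_mem_nhdsWithin).exists
    have mem : ∀ s : ℝ, |s| = t → (Matrix.of fun i j => x i j + s * z i j) ∈
        transportationPolytope u v := by
      intro s hs
      refine ⟨fun i => ?_, fun j => ?_, fun i j => ?_⟩
      · simp [sum_add_distrib, ← mul_sum, hz.row, hxP.1]
      · simp [sum_add_distrib, ← mul_sum, hz.col, hxP.2.1]
      · have h1 := ht i j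
        rw [← hs, ← abs_mul] at h1
        have := neg_abs_le (s * z i j)
        simp only [Matrix.of_apply]
        linarith
    have := hx.2 (mem t (abs_of_pos ht0)) (mem (-t) (by rw [abs_neg, abs_of_pos ht0]))
      ⟨1 / 2, 1 / 2, by norm_num, by norm_num, by norm_num, by
        ext i j
        simp
        ring⟩
    intro i j
    have hij := congrFun (congrFun this i) j
    simp only [Matrix.of_apply] at hij
    have : t * z i j = 0 := by linarith
    exact (mul_eq_zero.1 this).resolve_left ht0.ne'
  · intro hx
    refine ⟨hx.mem_polytope, fun a ha b hb hz => ?_⟩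
    have := hx.ker _ (zeroMargin_sub ha hx.mem_polytope) fun i j hij => by
      simp [eq_zero_of_mem_openSegment ha hb hz hij, hij]
    ext i j
    have := this i j
    simp only [Matrix.of_apply] at this
    linarith

/-- A linear functional on matrices. -/
noncomputable def pair (W y : Matrix (Fin 3) (Fin n) ℝ) : ℝ := ∑ i, ∑ j, W i j * y i j

theorem pair_add_smul (W y z : Matrix (Fin 3) (Fin n) ℝ) (t : ℝ) :
    pair W (Matrix.of fun i j => y i j + t * z i j) = pair W y + t * pair W z := by
  simp only [pair, Matrix.of_apply, mul_add, sum_add_distrib, mul_sum, mul_left_comm t]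

/-- A linear functional on a transportation polytope does not exceed its value at a given point
at some basic solution. -/
theorem exists_isBasic_pair_le (W : Matrix (Fin 3) (Fin n) ℝ)
    (hy : y ∈ transportationPolytope u v) :
    ∃ x, IsBasic u v x ∧ pair W x ≤ pair W y := by
  induction hk : (supp y).card using Nat.strong_induction_on generalizing y with
  | _ k ih =>
    by_cases hb : IsBasic u v y
    · exact ⟨y, hb, le_rfl⟩
    -- move along a circulation that does not increase `W` until an entry vanishes
    have : ∃ z : Matrix (Fin 3) (Fin n) ℝ, ZeroMargin z ∧ (∀ i j, y i j = 0 → z i j = 0) ∧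
        (∃ i j, z i j ≠ 0) ∧ pair W z ≤ 0 := by
      have : ∃ z : Matrix (Fin 3) (Fin n) ℝ, ZeroMargin z ∧ (∀ i j, y i j = 0 → z i j = 0) ∧
          ∃ i j, z i j ≠ 0 := by
        by_contra! h
        exact hb ⟨hy.2.2, hy.1, hy.2.1, h⟩
      obtain ⟨z, hz, h0, i, j, hij⟩ := this
      rcases le_total (pair W z) 0 with hle | hle
      · exact ⟨z, hz, h0, ⟨i, j, hij⟩, hle⟩
      · refine ⟨-z, ⟨fun i => ?_, fun j => ?_⟩, fun i j h => ?_, ⟨i, j, ?_⟩, ?_⟩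
        · simp [hz.row]
        · simp [hz.col]
        · simp [h0 i j h]
        · simpa using hij
        · simpa [pair] using hle
    obtain ⟨z, hz, h0, ⟨i, j, hij⟩, hW⟩ := this
    have hneg : (univ.filter fun e : Fin 3 × Fin n => z e.1 e.2 < 0).Nonempty := by
      by_contra hne
      have hnn : ∀ i j, 0 ≤ z i j := fun i j => not_lt.1 fun hlt =>
        hne ⟨(i, j), by simpa using hlt⟩
      exact hij ((sum_eq_zero_iff_of_nonneg fun j _ => hnn i j).1 (hz.row i) j (mem_univ _))
    obtain ⟨r, hr, hmin⟩ := exists_min_image _ (fun e => y e.1 e.2 / -z e.1 e.2) hneg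
    simp only [mem_filter, mem_univ, true_and] at hr hmin
    set t := y r.1 r.2 / -z r.1 r.2 with ht
    have ht0 : 0 ≤ t := div_nonneg (hy.2.2 _ _) (by linarith)
    have htr : y r.1 r.2 + t * z r.1 r.2 = 0 := by
      rw [ht, div_neg, neg_mul, div_mul_cancel₀ _ hr.ne, add_neg_cancel]
    have hmem : (Matrix.of fun i j => y i j + t * z i j) ∈ transportationPolytope u v := by
      refine ⟨fun i => ?_, fun j => ?_, fun i j => ?_⟩
      · simp [sum_add_distrib, ← mul_sum, hz.row, hy.1]
      · simp [sum_add_distrib, ← mul_sum, hz.col, hy.2.1]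
      · simp only [Matrix.of_apply]
        rcases lt_or_ge (z i j) 0 with hlt | hge
        · have := hmin (i, j) hlt
          rw [le_div_iff₀ (by linarith)] at this
          linarith
        · have := hy.2.2 i j
          positivity
    have hlt : (supp (Matrix.of fun i j => y i j + t * z i j)).card < k := by
      rw [← hk]
      refine card_lt_card ((ssubset_iff_of_subset fun e he => ?_).2 ⟨r, ?_, ?_⟩)
      · rw [mem_supp] at he ⊢
        refine (hy.2.2 _ _).lt_of_ne' fun h => ?_
        simp [h, h0 _ _ h] at he
      · rw [mem_supp]
        exact (hy.2.2 _ _).lt_of_ne' fun h => hr.ne (h0 _ _ h)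
      · rw [mem_supp, Matrix.of_apply, htr]
        exact lt_irrefl _
    obtain ⟨x, hx, hle⟩ := ih _ hlt hmem rfl
    refine ⟨x, hx, hle.trans ?_⟩
    rw [pair_add_smul]
    have := mul_nonneg_of_nonpos_of_nonpos (neg_nonpos.2 ht0) hW
    linarith

/-- Two points of a transportation polytope supported in the support of a basic solution for
possibly other margins coincide. -/
theorem IsBasic.eq_of_supp_subset_supp {U : Fin 3 → ℝ} {V : Fin n → ℝ}
    {b : Matrix (Fin 3) (Fin n) ℝ} (hb : IsBasic U V b) (hx : IsBasic u v x) (hy : IsBasic u v y)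
    (hxb : supp x ⊆ supp b) (hyb : supp y ⊆ supp b) : x = y := by
  have vanish : ∀ {a : Matrix (Fin 3) (Fin n) ℝ}, IsBasic u v a → supp a ⊆ supp b →
      ∀ {i j}, b i j = 0 → a i j = 0 := by
    intro a ha hab i j hij
    refine (ha.pos_or_zero i j).resolve_left fun hpos => ?_
    have : (i, j) ∈ supp b := hab (by simpa using hpos)
    simp [hij] at this
  have := hb.ker _ (zeroMargin_sub hx.mem_polytope hy.mem_polytope) fun i j hij => by
    simp [vanish hx hxb hij, vanish hy hyb hij]
  ext i j
  have := this i j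
  simp only [Matrix.of_apply] at this
  linarith

/-- Vertices supported in the supports of two basic solutions related by a pivot, possibly for
other margins, coincide or span an edge. -/
theorem IsPivot.eq_or_isExtreme_segment {U : Fin 3 → ℝ} {V : Fin n → ℝ}
    {b b' : Matrix (Fin 3) (Fin n) ℝ} {e r : Fin 3 × Fin n} (hp : IsPivot U V b e r b')
    (hb : IsBasic U V b) (hx : IsBasic u v x) (hy : IsBasic u v y) (hxb : supp x ⊆ supp b)
    (hyb : supp y ⊆ supp b') :
    x = y ∨ IsExtreme ℝ (transportationPolytope u v) (segment ℝ x y) := by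
  by_cases hxy : x = y
  · exact Or.inl hxy
  refine Or.inr ⟨?_, ?_⟩
  · rintro _ ⟨s, t, hs, ht, hst, rfl⟩
    refine ⟨fun i => ?_, fun j => ?_, fun i j => ?_⟩
    · simp [sum_add_distrib, ← mul_sum, hx.row, hy.row, ← add_mul, hst]
    · simp [sum_add_distrib, ← mul_sum, hx.col, hy.col, ← add_mul, hst]
    · have := hx.nonneg i j
      have := hy.nonneg i j
      simp only [Matrix.add_apply, Matrix.smul_apply, smul_eq_mul]
      positivity
  have hyb2 : ∀ i j, b i j = 0 → (i, j) ≠ e → y i j = 0 := by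
    intro i j hij hne
    refine (hy.pos_or_zero i j).resolve_left fun hpos => ?_
    have : (i, j) ∈ supp b' := hyb (by simpa using hpos)
    rw [hp.supp_eq, mem_insert, mem_erase, mem_supp] at this
    exact this.elim hne fun h => h.2.ne' hij
  have hxb2 : ∀ i j, b i j = 0 → x i j = 0 := by
    intro i j hij
    refine (hx.pos_or_zero i j).resolve_left fun hpos => ?_
    have : (i, j) ∈ supp b := hxb (by simpa using hpos)
    simp [hij] at this
  have hbe : b e.1 e.2 = 0 := (hb.pos_or_zero _ _).resolve_left fun h => hp.enter (by simpa using h)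
  have hxe : x e.1 e.2 = 0 := hxb2 _ _ hbe
  have hye : 0 < y e.1 e.2 := by
    refine (hy.pos_or_zero _ _).resolve_right fun h0 => hxy ?_
    refine hb.eq_of_supp_subset_supp hx hy hxb fun a ha => ?_
    have := hyb ha
    rw [hp.supp_eq, mem_insert, mem_erase] at this
    rcases this with rfl | h
    · rw [mem_supp] at ha
      exact absurd h0 ha.ne'
    · exact h.2
  have hyr : y r.1 r.2 = 0 := by
    refine (hy.pos_or_zero _ _).resolve_left fun hpos => ?_
    have : r ∈ supp b' := hyb (by simpa using hpos)
    rw [hp.supp_eq, mem_insert, mem_erase] at this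
    rcases this with h | h
    · exact hp.enter (h ▸ hp.leave)
    · exact h.1 rfl
  have hxr : 0 < x r.1 r.2 := by
    refine (hx.pos_or_zero _ _).resolve_right fun h0 => hxy ?_
    refine hp.basic.eq_of_supp_subset_supp hx hy (fun a ha => ?_) hyb
    rw [hp.supp_eq]
    refine mem_insert_of_mem (mem_erase.2 ⟨?_, hxb ha⟩)
    rintro rfl
    rw [mem_supp] at ha
    exact ha.ne' h0
  intro a ha a' ha' w hw hwa
  have hazero : ∀ i j, b i j = 0 → (i, j) ≠ e → a i j = 0 := by
    intro i j hij hne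
    refine eq_zero_of_mem_openSegment ha ha' hwa ?_
    obtain ⟨s, t, -, -, -, rfl⟩ := hw
    simp [hxb2 i j hij, hyb2 i j hij hne]
  -- the matrices with zero margins supported in `supp b` and `e` form a line
  set s := a e.1 e.2 / y e.1 e.2 with hs
  have hse : s * y e.1 e.2 = a e.1 e.2 := div_mul_cancel₀ _ hye.ne'
  have hker := hb.ker _ ((zeroMargin_sub ha hx.mem_polytope).sub_smul
    (zeroMargin_sub hy.mem_polytope hx.mem_polytope) s) fun i j hij => by
      by_cases hne : (i, j) = e
      · subst hne
        simp only [Matrix.of_apply]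
        simp only at hxe hse
        rw [hxe]
        linarith
      · simp [hxb2 i j hij, hyb2 i j hij hne, hazero i j hij hne]
  have haeq : ∀ i j, a i j = (1 - s) * x i j + s * y i j := by
    intro i j
    have := hker i j
    simp only [Matrix.of_apply] at this
    linarith
  have hs0 : 0 ≤ s := div_nonneg (ha.2.2 _ _) hye.le
  have hs1 : 0 ≤ 1 - s := by
    have h1 := ha.2.2 r.1 r.2
    rw [haeq, hyr, mul_zero, add_zero] at h1
    exact nonneg_of_mul_nonneg_left h1 hxr
  refine ⟨1 - s, s, hs1, hs0, by ring, ?_⟩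
  ext i j
  simp [haeq]

/-- A walk of pivots, possibly for other margins, induces a walk on the graph of the polytope. -/
theorem PivotWalk.edist_le {U : Fin 3 → ℝ} {V : Fin n → ℝ} {f b : Matrix (Fin 3) (Fin n) ℝ} {k : ℕ}
    (hw : PivotWalk U V f k b)
    (hlim : ∀ b, IsBasic U V b → ∃ x, IsBasic u v x ∧ supp x ⊆ supp b)
    (hb : IsBasic U V b) (x y : (transportationPolytope u v).extremePoints ℝ)
    (hx : supp x.1 ⊆ supp b) (hy : supp y.1 ⊆ supp f) :
    (polytopeGraph (transportationPolytope u v)).edist x y ≤ k := by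
  induction hw generalizing x with
  | refl =>
    have : x = y := Subtype.ext (hb.eq_of_supp_subset_supp (mem_extremePoints_iff_isBasic.1 x.2)
      (mem_extremePoints_iff_isBasic.1 y.2) hx hy)
    rw [this, SimpleGraph.edist_self]
    exact zero_le
  | @step k b e r b' hp _ ih =>
    obtain ⟨z, hz, hzb⟩ := hlim b' hp.basic
    have h1 := ih hp.basic ⟨z, mem_extremePoints_iff_isBasic.2 hz⟩ hzb
    have h2 : (polytopeGraph (transportationPolytope u v)).edist x
        ⟨z, mem_extremePoints_iff_isBasic.2 hz⟩ ≤ 1 := by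
      rw [SimpleGraph.edist_le_one_iff_adj_or_eq]
      by_cases hxz : x = ⟨z, mem_extremePoints_iff_isBasic.2 hz⟩
      · exact Or.inr hxz
      · refine Or.inl ⟨hxz, ?_⟩
        exact (hp.eq_or_isExtreme_segment hb (mem_extremePoints_iff_isBasic.1 x.2) hz hx
          hzb).resolve_left fun h => hxz (Subtype.ext h)
    calc _ ≤ _ := SimpleGraph.edist_triangle
      _ ≤ 1 + (k : ℕ∞) := add_le_add h2 h1
      _ = _ := by push_cast; exact add_comm _ _

end

/-! ### Generic perturbations -/

/-- Row margins perturbed in the direction `(1/3, 1/3, n - 2/3)`. -/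
noncomputable def rowPerturb (u : Fin 3 → ℝ) (n : ℕ) (ε : ℝ) (i : Fin 3) : ℝ :=
  u i + ε * (if i = 2 then (n : ℝ) - 2 / 3 else 1 / 3)

/-- Column margins perturbed in the direction `(1, …, 1)`. -/
noncomputable def colPerturb (v : Fin n → ℝ) (ε : ℝ) (j : Fin n) : ℝ := v j + ε

/-- In the perturbing direction row margins have denominator `3` and column margins are integers,
so each of the finitely many coincidences excluded by `Generic` occurs for at most one `ε`. -/
theorem eventually_generic (u : Fin 3 → ℝ) {v : Fin n → ℝ} (hv : ∀ j, 0 < v j) :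
    ∀ᶠ ε : ℝ in 𝓝[>] 0, Generic (rowPerturb u n ε) (colPerturb v ε) := by
  have key : ∀ a b : ℝ, b ≠ 0 → ∀ᶠ ε : ℝ in 𝓝[>] 0, a + ε * b ≠ 0 := by
    intro a b hb
    rcases eq_or_ne a 0 with rfl | ha
    · filter_upwards [self_mem_nhdsWithin] with ε hε
      rw [zero_add]
      exact mul_ne_zero hε.ne' hb
    · have : Tendsto (fun ε : ℝ => a + ε * b) (𝓝[>] 0) (𝓝 (a + 0 * b)) :=
        ((tendsto_id.mono_left nhdsWithin_le_nhds).mul_const _).const_add _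
      rw [zero_mul, add_zero] at this
      exact this.eventually_ne ha
  have hne : ∀ᶠ ε : ℝ in 𝓝[>] 0, ∀ i (J : Finset (Fin n)),
      rowPerturb u n ε i ≠ ∑ j ∈ J, colPerturb v ε j := by
    simp only [eventually_all]
    intro i J
    have hb : (if i = 2 then (n : ℝ) - 2 / 3 else 1 / 3) - J.card ≠ 0 := by
      intro h
      split_ifs at h
      · have : (3 * n : ℝ) = 3 * J.card + 2 := by linarith
        have : 3 * n = 3 * J.card + 2 := by exact_mod_cast this
        omega
      · have : (1 : ℝ) = 3 * J.card := by linarith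
        have : 1 = 3 * J.card := by exact_mod_cast this
        omega
    filter_upwards [key (u i - ∑ j ∈ J, v j) _ hb] with ε hε h
    apply hε
    simp only [rowPerturb, colPerturb, sum_add_distrib, sum_const, nsmul_eq_mul] at h
    linarith
  filter_upwards [hne, self_mem_nhdsWithin] with ε h1 h2
  exact ⟨fun j => add_pos (hv j) h2, h1⟩

section

variable {u : Fin 3 → ℝ} {v : Fin n → ℝ} {x : Matrix (Fin 3) (Fin n) ℝ}

/-- Some basic solution for the margins perturbed by `ε` has support `T`, and the functional `W`
is at most `c * ε` there. -/
def SuppAt (u : Fin 3 → ℝ) (v : Fin n → ℝ) (W : Matrix (Fin 3) (Fin n) ℝ) (c : ℝ)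
    (T : Finset (Fin 3 × Fin n)) (ε : ℝ) : Prop :=
  ∃ y, IsBasic (rowPerturb u n ε) (colPerturb v ε) y ∧ supp y = T ∧ pair W y ≤ c * ε

/-- Basic solutions with a fixed support depend affinely on the perturbation, so they converge to
a basic solution for the original margins. -/
theorem exists_limit {W : Matrix (Fin 3) (Fin n) ℝ} {c : ℝ} {T : Finset (Fin 3 × Fin n)}
    (h : ∃ᶠ ε in 𝓝[>] 0, SuppAt u v W c T ε) :
    ∃ x, IsBasic u v x ∧ supp x ⊆ T ∧ pair W x ≤ 0 := by
  obtain ⟨ε₁, ⟨y₁, hy₁, hT₁, -⟩, hε₁⟩ := (h.and_eventually self_mem_nhdsWithin).exists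
  obtain ⟨ε₂, ⟨y₂, hy₂, hT₂, -⟩, hε₂⟩ := (h.and_eventually
    ((gt_mem_nhds hε₁).filter_mono nhdsWithin_le_nhds)).exists
  have hd : ε₂ - ε₁ ≠ 0 := sub_ne_zero.2 hε₂.ne
  set z₁ : Matrix (Fin 3) (Fin n) ℝ := Matrix.of fun i j => (ε₂ - ε₁)⁻¹ * (y₂ i j - y₁ i j)
  set z₀ : Matrix (Fin 3) (Fin n) ℝ := Matrix.of fun i j => y₁ i j - ε₁ * z₁ i j with hz₀
  have r₁ : ∀ i, ∑ j, z₁ i j = if i = 2 then (n : ℝ) - 2 / 3 else 1 / 3 := by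
    intro i
    simp only [z₁, Matrix.of_apply, ← mul_sum, sum_sub_distrib, hy₁.row, hy₂.row, rowPerturb]
    rw [inv_mul_eq_iff_eq_mul₀ hd]
    ring
  have c₁ : ∀ j, ∑ i, z₁ i j = 1 := by
    intro j
    simp only [z₁, Matrix.of_apply, ← mul_sum, sum_sub_distrib, hy₁.col, hy₂.col, colPerturb]
    rw [inv_mul_eq_iff_eq_mul₀ hd]
    ring
  have r₀ : ∀ i, ∑ j, z₀ i j = u i := by
    intro i
    simp only [z₀, Matrix.of_apply, ← mul_sum, sum_sub_distrib, hy₁.row, r₁, rowPerturb]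
    ring
  have c₀ : ∀ j, ∑ i, z₀ i j = v j := by
    intro j
    simp only [z₀, Matrix.of_apply, ← mul_sum, sum_sub_distrib, hy₁.col, c₁, colPerturb]
    ring
  have hT : ∀ {y : Matrix (Fin 3) (Fin n) ℝ} {U : Fin 3 → ℝ} {V : Fin n → ℝ}, IsBasic U V y →
      supp y = T → ∀ i j, (y i j = 0 ↔ (i, j) ∉ T) := by
    rintro y U V hy rfl i j
    rw [mem_supp, not_lt]
    exact ⟨fun h => h.le, fun h => le_antisymm h (hy.nonneg _ _)⟩
  have hz₁T : ∀ i j, (i, j) ∉ T → z₁ i j = 0 := fun i j hij => by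
    simp [z₁, (hT hy₁ hT₁ i j).2 hij, (hT hy₂ hT₂ i j).2 hij]
  have hz₀T : ∀ i j, (i, j) ∉ T → z₀ i j = 0 := fun i j hij => by
    simp [z₀, (hT hy₁ hT₁ i j).2 hij, hz₁T i j hij]
  have haff : ∀ ε y, IsBasic (rowPerturb u n ε) (colPerturb v ε) y → supp y = T →
      y = Matrix.of fun i j => z₀ i j + ε * z₁ i j := by
    intro ε y hy hyT
    have hm : ZeroMargin (Matrix.of fun i j => y i j - (z₀ i j + ε * z₁ i j)) := by
      constructor
      · intro i
        simp only [Matrix.of_apply, sum_sub_distrib, sum_add_distrib, ← mul_sum, hy.row, r₀, r₁,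
          rowPerturb]
        ring
      · intro j
        simp only [Matrix.of_apply, sum_sub_distrib, sum_add_distrib, ← mul_sum, hy.col, c₀, c₁,
          colPerturb]
        ring
    have := hy.ker _ hm fun i j hij => by
      have hn := (hT hy hyT i j).1 hij
      simp [hij, hz₀T i j hn, hz₁T i j hn]
    ext i j
    have := this i j
    simp only [Matrix.of_apply] at this ⊢
    linarith
  have tends : ∀ a b : ℝ, Tendsto (fun ε : ℝ => a + ε * b) (𝓝[>] 0) (𝓝 a) := by
    intro a b
    have : Tendsto (fun ε : ℝ => a + ε * b) (𝓝[>] 0) (𝓝 (a + 0 * b)) :=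
      ((tendsto_id.mono_left nhdsWithin_le_nhds).mul_const _).const_add _
    rwa [zero_mul, add_zero] at this
  refine ⟨z₀, ⟨fun i j => ?_, r₀, c₀, fun z hz h0 => hy₁.ker z hz fun i j hij => ?_⟩,
    fun e he => ?_, ?_⟩
  · refine ge_of_tendsto_of_frequently (tends (z₀ i j) (z₁ i j)) (h.mono ?_)
    rintro ε ⟨y, hy, hyT, -⟩
    have := hy.nonneg i j
    rw [haff ε y hy hyT] at this
    exact this
  · exact h0 i j (hz₀T i j ((hT hy₁ hT₁ i j).1 hij))
  · by_contra hn
    rw [mem_supp, hz₀T _ _ hn] at he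
    exact lt_irrefl _ he
  · have hlim : Tendsto (fun ε : ℝ => pair W z₀ + ε * (pair W z₁ - c)) (𝓝[>] 0) (𝓝 (pair W z₀)) :=
      tends _ _
    refine le_of_tendsto_of_frequently hlim (h.mono ?_)
    rintro ε ⟨y, hy, hyT, hle⟩
    rw [haff ε y hy hyT, pair_add_smul] at hle
    linarith

/-- For all small perturbations, the supports of basic solutions recur for arbitrarily small
perturbations. -/
theorem eventually_frequently (W : Matrix (Fin 3) (Fin n) ℝ) (c : ℝ) :
    ∀ᶠ ε in 𝓝[>] 0, ∀ T, SuppAt u v W c T ε → ∃ᶠ ε' in 𝓝[>] 0, SuppAt u v W c T ε' := by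
  rw [eventually_all]
  intro T
  by_cases h : ∃ᶠ ε' in 𝓝[>] 0, SuppAt u v W c T ε'
  · exact Eventually.of_forall fun _ _ => h
  · filter_upwards [not_frequently.1 h] with ε hε hε'
    exact absurd hε' hε

/-- Every vertex is a limit of basic solutions for perturbed margins: near `x` there are feasible
points whose weight outside the support of `x` is of the order of the perturbation. -/
theorem IsBasic.eventually_exists_supp_subset (hx : IsBasic u v x) (hn : 0 < n) :
    ∀ᶠ ε in 𝓝[>] 0, ∃ y, IsBasic (rowPerturb u n ε) (colPerturb v ε) y ∧ supp x ⊆ supp y := by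
  have hn1 : (1 : ℝ) ≤ n := by exact_mod_cast hn
  have hn0 : (n : ℝ) ≠ 0 := by positivity
  set W : Matrix (Fin 3) (Fin n) ℝ := Matrix.of fun i j => if 0 < x i j then 0 else 1
  -- a nonnegative matrix whose margins are the perturbing direction
  set z : Matrix (Fin 3) (Fin n) ℝ :=
    Matrix.of fun i _ => (if i = 2 then (n : ℝ) - 2 / 3 else 1 / 3) / n with hz
  have hWx : pair W x = 0 := by
    refine sum_eq_zero fun i _ => sum_eq_zero fun j _ => ?_
    rcases hx.pos_or_zero i j with h | h
    · simp [W, h]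
    · simp [h]
  filter_upwards [eventually_frequently (u := u) (v := v) W (pair W z), self_mem_nhdsWithin]
    with ε h1 h2
  have h2 : 0 < ε := h2
  have hmem : (Matrix.of fun i j => x i j + ε * z i j) ∈
      transportationPolytope (rowPerturb u n ε) (colPerturb v ε) := by
    refine ⟨fun i => ?_, fun j => ?_, fun i j => ?_⟩
    · simp only [Matrix.of_apply, sum_add_distrib, ← mul_sum, hx.row, rowPerturb, hz, sum_const,
        card_univ, Fintype.card_fin, nsmul_eq_mul]
      rw [mul_div_cancel₀ _ hn0]
    · simp only [Matrix.of_apply, sum_add_distrib, ← mul_sum, hx.col, colPerturb, hz, ← sum_div]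
      rw [Fin.sum_univ_three]
      simp only [Fin.isValue, Fin.reduceEq, if_false, if_true]
      field_simp
      ring
    · have := hx.nonneg i j
      have : 0 ≤ z i j := by
        simp only [hz, Matrix.of_apply]
        split_ifs
        · apply div_nonneg <;> linarith
        · positivity
      simp only [Matrix.of_apply]
      positivity
  obtain ⟨y, hy, hle⟩ := exists_isBasic_pair_le W hmem
  rw [pair_add_smul, hWx, zero_add, mul_comm] at hle
  obtain ⟨x', hx', hsub, hle'⟩ := exists_limit (h1 _ ⟨y, hy, rfl, hle⟩)
  have hnn : ∀ i j, 0 ≤ W i j * x' i j := fun i j => by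
    have := hx'.nonneg i j
    simp only [W, Matrix.of_apply]
    split_ifs <;> simp [this]
  have hxx' : x = x' := by
    refine hx.eq_of_supp_subset_supp hx hx' subset_rfl fun e he => ?_
    rw [mem_supp] at he ⊢
    by_contra hne
    have h0 := le_antisymm hle' (sum_nonneg fun i _ => sum_nonneg fun j _ => hnn i j)
    rw [pair, sum_eq_zero_iff_of_nonneg fun i _ => sum_nonneg fun j _ => hnn i j] at h0
    have := (sum_eq_zero_iff_of_nonneg fun j _ => hnn e.1 j).1 (h0 e.1 (mem_univ _)) e.2
      (mem_univ _)
    simp [W, hne] at this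
    exact he.ne' this
  exact ⟨y, hy, hxx' ▸ hsub⟩

/-- Any two vertices `x`, `y` are joined by a path of at most `n + 2 - k` edges, `k` being the
number of critical edges. -/
theorem exists_edist_le (hv : ∀ j, 0 < v j) (hn : 0 < n)
    (x y : (transportationPolytope u v).extremePoints ℝ) :
    ∃ k : ℕ, (polytopeGraph (transportationPolytope u v)).edist x y ≤ k ∧
      k + (criticalEdges u v).ncard ≤ n + 2 := by
  obtain ⟨ε, hg, hlim, ⟨a, ha, hxa⟩, b, hb, hyb⟩ := ((eventually_generic u hv).and
    ((eventually_frequently (u := u) (v := v) 0 0).and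
      (((mem_extremePoints_iff_isBasic.1 x.2).eventually_exists_supp_subset hn).and
        ((mem_extremePoints_iff_isBasic.1 y.2).eventually_exists_supp_subset hn)))).exists
  have hlim : ∀ b, IsBasic (rowPerturb u n ε) (colPerturb v ε) b →
      ∃ x, IsBasic u v x ∧ supp x ⊆ supp b := by
    intro b hb
    obtain ⟨x, hx, hxb, -⟩ := exists_limit (hlim _ ⟨b, hb, rfl, by simp [pair]⟩)
    exact ⟨x, hx, hxb⟩
  have hK : ∀ b, IsBasic (rowPerturb u n ε) (colPerturb v ε) b →
      (Set.toFinite (criticalEdges u v)).toFinset ⊆ supp b := by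
    intro b hb e he
    obtain ⟨x, hx, hxb⟩ := hlim b hb
    rw [Set.Finite.mem_toFinset] at he
    exact hxb (mem_supp.2 (he x hx.mem_polytope))
  obtain ⟨k, hk, hw⟩ := exists_pivotWalk hg hK ha hb
  rw [← Set.ncard_eq_toFinset_card] at hk
  exact ⟨k, hw.edist_le hlim ha x y hxa hyb, hk⟩

end

end Transport

theorem theorem4 (n : ℕ) (u : Fin 3 → ℝ) (v : Fin n → ℝ)
    (hu : ∀ i, 0 < u i) (hv : ∀ j, 0 < v j)
    (hP : (transportationPolytope u v).Nonempty) :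
    (polytopeGraph (transportationPolytope u v)).ediam + ((criticalEdges u v).ncard : ℕ∞)
        ≤ (n : ℕ∞) + 2 ∧
      (polytopeGraph (transportationPolytope u v)).ediam ≤ (n : ℕ∞) + 2 := by
  obtain ⟨y, hy⟩ := hP
  have hn : 0 < n := by
    rcases Nat.eq_zero_or_pos n with rfl | hn
    · have h1 := hu 0
      rw [← hy.1 0] at h1
      simp at h1
    · exact hn
  obtain ⟨x, hx, -⟩ := Transport.exists_isBasic_pair_le 0 hy
  have hk : (criticalEdges u v).ncard ≤ n + 2 := by
    have hx' := Transport.mem_extremePoints_iff_isBasic.2 hx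
    obtain ⟨k, -, hk⟩ := Transport.exists_edist_le hv hn ⟨x, hx'⟩ ⟨x, hx'⟩
    omega
  have hd : (polytopeGraph (transportationPolytope u v)).ediam ≤
      ((n + 2 - (criticalEdges u v).ncard : ℕ) : ℕ∞) := by
    refine SimpleGraph.ediam_le_of_edist_le fun a b => ?_
    obtain ⟨k, h1, h2⟩ := Transport.exists_edist_le hv hn a b
    exact h1.trans (by exact_mod_cast Nat.le_sub_of_add_le h2)
  have hsum : (polytopeGraph (transportationPolytope u v)).ediam +
      ((criticalEdges u v).ncard : ℕ∞) ≤ (n : ℕ∞) + 2 := by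
    calc _ ≤ ((n + 2 - (criticalEdges u v).ncard : ℕ) : ℕ∞) + ((criticalEdges u v).ncard : ℕ∞) :=
          add_le_add hd le_rfl
      _ = ((n + 2 : ℕ) : ℕ∞) := by rw [← Nat.cast_add, Nat.sub_add_cancel hk]
      _ = _ := by push_cast; rfl
  exact ⟨hsum, le_self_add.trans hsum⟩
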